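/- Let $k$ be a commutative artinian ring and $R$ an artin $k$-algebra (a $k$-algebra that is finitely generated as a $k$-module). Let $\mathrm{mod}\,R$ be the category of finitely generated left $R$-modules, $\mathcal D=\mathcal D^b(\mathrm{mod}\,R)$ its bounded derived category, and $D=\mathrm{Hom}_k(-,E)$ the usual duality between $\mathrm{mod}\,R$ and $\mathrm{mod}\,R^{op}$, where $E$ is the injective envelope of $k/\mathrm{rad}\,k$; the induced duality $\mathcal D^b(\mathrm{mod}\,R)\to\mathcal D^b(\mathrm{mod}\,R^{op})$ is also denoted by $D$. Modules are regarded as stalk complexes in degree $0$. For $T\in\mathcal D$ use the following notation (likewise over $R^{op}$). * $T$ is semi-selforthogonal if $\mathrm{Hom}_{\mathcal D}(T,T[i])=0$ for all $i>0$. $\mathrm{add}_{\mathcal D}T$ is the class of direct summands of finite direct sums of copies of $T$. $T^{\perp_{>0}}$ (resp. ${}^{\perp_{>0}}T$) is the class of all $N\in\mathcal D$ with $\mathrm{Hom}_{\mathcal D}(T,N[i])=0$ (resp. $\mathrm{Hom}_{\mathcal D}(N,T[i])=0$) for all $i>0$. For a finite interval $I$ of integers, $\mathcal D^I$ is the class of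 complexes with cohomology concentrated in $I$. * The Auslander class ${}_T\mathcal X^\flat$ consists of all $X\in\mathcal D$ for which there are a finite interval $I$ with $T\in\mathcal D^I$ and triangles $X_{i+1}\to T_i\to X_i\to X_{i+1}[1]$ ($i\ge 0$) with $X_0=X$, all $T_i\in\mathrm{add}_{\mathcal D}T$ and all $X_i\in T^{\perp_{>0}}\cap\mathcal D^I$. * The co-Auslander class $\mathcal X_T^\flat$ consists of all $X\in\mathcal D$ for which there are a finite interval $I$ with $T\in\mathcal D^I$ and triangles $X_i\to T_i\to X_{i+1}\to X_i[1]$ ($i\ge 0$) with $X_0=X$, all $T_i\in\mathrm{add}_{\mathcal D}T$ and all $X_i\in{}^{\perp_{>0}}T\cap\mathcal D^I$. * For a class $\mathcal C$ of objects, $\langle\mathcal C\rangle_+$ (resp. $\langle\mathcal C\rangle_-$) is the class of objects isomorphic to $C[n]$ with $C\in\mathcal C$ and $n\ge 0$ (resp. $n\le 0$). * $T$ is Wakamatsu-silting if it is semi-selforthogonal and $R\in\langle\mathcal X_T^\flat\rangle_+$. Then for every $T\in\mathcal D^b(\mathrm{mod}\,R)$ the following are equivalent: 1. $T$ is Wakamatsu-silting;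 2. $T$ is semi-selforthogonal and $DR\in\langle{}_T\mathcal X^\flat\rangle_-$, where $DR$ is the left $R$-module dual to the right module $R_R$; 3. $DT\in\mathcal D^b(\mathrm{mod}\,R^{op})$ is Wakamatsu-silting. -/

import Mathlib

open CategoryTheory

universe u v u' v' w w'

namespace WakamatsuSilting

noncomputable section

/-- `i : M → E` is an injective envelope: a monomorphism into an injective module whose image
meets every nonzero submodule of `E` nontrivially. -/
structure IsInjectiveEnvelope {A : Type u} [Ring A] {M E : Type u} [AddCommGroup M] [Module A M]
    [AddCommGroup E] [Module A E] (i : M →ₗ[A] E) : Prop where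
  injective : Function.Injective i
  injective_module : Module.Injective A E
  essential : ∀ N : Submodule A E, N ⊓ LinearMap.range i = ⊥ → N = ⊥

/-- Every module has an injective envelope. -/
theorem exists_isInjectiveEnvelope (A : Type u) [Ring A] (M : Type u) [AddCommGroup M]
    [Module A M] : ∃ (E : ModuleCat.{u} A) (i : M →ₗ[A] E), IsInjectiveEnvelope i := by
  obtain ⟨I, hI, j, hj⟩ : ∃ (I : ModuleCat.{u} A) (_ : Module.Injective A I) (j : M →ₗ[A] I),
      Function.Injective j := by
    refine ⟨Injective.under (ModuleCat.of A M), ?_, (Injective.ι (ModuleCat.of A M)).hom, ?_⟩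
    · exact (Module.injective_iff_injective_object A _).2
        (inferInstanceAs (Injective (Injective.under (ModuleCat.of A M))))
    · exact (ModuleCat.mono_iff_injective _).1 inferInstance
  let N₀ : Submodule A I := LinearMap.range j
  let S : Set (Submodule A I) := {N | N₀ ≤ N ∧ ∀ P ≤ N, P ⊓ N₀ = ⊥ → P = ⊥}
  obtain ⟨N, hN₀, hN⟩ : ∃ N, N₀ ≤ N ∧ Maximal (· ∈ S) N := by
    refine zorn_le_nonempty₀ S (fun c hcS hc N hNc => ⟨sSup c, ⟨?_, ?_⟩, fun z => le_sSup⟩) N₀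
      ⟨le_rfl, fun P hP h => by rwa [inf_eq_left.2 hP] at h⟩
    · exact (hcS hNc).1.trans (le_sSup hNc)
    · intro P hP hPN
      rw [Submodule.eq_bot_iff]
      intro x hx
      obtain ⟨N', hN', hxN'⟩ := (Submodule.mem_sSup_of_directed ⟨N, hNc⟩ hc.directedOn).1 (hP hx)
      have := (hcS hN').2 (Submodule.span A {x}) (by simpa using hxN')
        (eq_bot_iff.2 ((inf_le_inf_right N₀ (by simpa using hx)).trans hPN.le))
      simpa using this
  obtain ⟨C, -, hC⟩ : ∃ C, ⊥ ≤ C ∧ Maximal (· ∈ {C : Submodule A I | C ⊓ N = ⊥}) C := by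
    refine zorn_le_nonempty₀ _ (fun c hcS hc C hCc => ⟨sSup c, ?_, fun z => le_sSup⟩) ⊥ (by simp)
    refine (Submodule.eq_bot_iff _).2 ?_
    rintro x ⟨hx, hxN⟩
    obtain ⟨C', hC', hxC'⟩ := (Submodule.mem_sSup_of_directed ⟨C, hCc⟩ hc.directedOn).1 hx
    have : x ∈ C' ⊓ N := ⟨hxC', hxN⟩
    rw [show C' ⊓ N = ⊥ from hcS hC'] at this
    simpa using this
  have hinj : Function.Injective (C.mkQ ∘ₗ N.subtype) := by
    rw [← LinearMap.ker_eq_bot, LinearMap.ker_eq_bot']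
    rintro ⟨x, hx⟩ h
    have h' : x ∈ C ⊓ N := ⟨by simpa using h, hx⟩
    rw [show C ⊓ N = ⊥ from hC.1] at h'
    simpa using h'
  obtain ⟨h, hh⟩ := hI.out (C.mkQ ∘ₗ N.subtype) hinj N.subtype
  have key : ∀ P : Submodule A (I ⧸ C), (∀ x ∈ N, C.mkQ x ∈ P → x = 0) → P = ⊥ := by
    intro P hP
    have hle : C ≤ P.comap C.mkQ := fun x hx => by
      have : C.mkQ x = 0 := by simpa using hx
      simp only [Submodule.mem_comap, this, P.zero_mem]
    have hmem : P.comap C.mkQ ⊓ N = ⊥ := by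
      rw [Submodule.eq_bot_iff]
      exact fun x hx => hP x hx.2 hx.1
    have hge := hC.2 hmem hle
    rw [Submodule.eq_bot_iff]
    intro y hy
    obtain ⟨x, rfl⟩ := C.mkQ_surjective y
    simpa using hge hy
  have hrange : LinearMap.range h ∈ S := by
    refine ⟨fun x hx => ⟨C.mkQ x, hh ⟨x, hN.1.1 hx⟩⟩, fun P hP hPN => ?_⟩
    have h1 : P ⊓ N = ⊥ := hN.1.2 _ inf_le_right
      (eq_bot_iff.2 ((inf_le_inf_right N₀ inf_le_left).trans hPN.le))
    have h2 : P.comap h = ⊥ := key _ fun x hx hxP => by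
      have : x ∈ P ⊓ N := ⟨(show h (C.mkQ x) = x from hh ⟨x, hx⟩) ▸ hxP, hx⟩
      rw [h1] at this
      simpa using this
    rw [Submodule.eq_bot_iff]
    intro x hx
    obtain ⟨y, rfl⟩ := hP hx
    have : y ∈ P.comap h := hx
    rw [h2] at this
    simp [(Submodule.mem_bot A).1 this]
  have hle : LinearMap.range h ≤ N :=
    hN.2 hrange fun x hx => ⟨C.mkQ x, hh ⟨x, hx⟩⟩
  let r : I →ₗ[A] N := LinearMap.codRestrict N (h ∘ₗ C.mkQ) fun x => hle ⟨_, rfl⟩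
  have hr : ∀ x : N, r x = x := fun x => Subtype.ext (hh x)
  refine ⟨ModuleCat.of A N, LinearMap.codRestrict N j fun x => hN₀ ⟨x, rfl⟩, ?_, ⟨?_⟩, ?_⟩
  · exact fun x y hxy => hj (congrArg Subtype.val hxy)
  · intro X Y _ _ _ _ f hf g
    obtain ⟨g', hg'⟩ := hI.out f hf (N.subtype ∘ₗ g)
    refine ⟨r ∘ₗ g', fun x => ?_⟩
    simp only [LinearMap.comp_apply, hg']
    exact hr (g x)
  · intro P hP
    have : P.map N.subtype = ⊥ := by
      refine hN.1.2 _ (Submodule.map_subtype_le N P) ?_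
      rw [Submodule.eq_bot_iff]
      rintro _ ⟨⟨x, hx, rfl⟩, ⟨m, hm⟩⟩
      have hx' : x ∈ P ⊓ LinearMap.range
          (LinearMap.codRestrict N j fun x => hN₀ ⟨x, rfl⟩) := ⟨hx, m, Subtype.ext hm⟩
      rw [hP] at hx'
      simp [(Submodule.mem_bot A).1 hx']
    exact Submodule.map_injective_of_injective N.subtype_injective (this.trans (Submodule.map_bot _).symm)

/-- If `E` is an injective envelope of a finitely generated module over a commutative artinian
ring `k`, then `Hom_k(N, E)` is finitely generated for every finitely generated `N`. -/
theorem IsInjectiveEnvelope.finite_hom {k : Type u} [CommRing k] [IsArtinianRing k]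
    {M E : Type u} [AddCommGroup M] [Module k M] [Module.Finite k M]
    [AddCommGroup E] [Module k E] {i : M →ₗ[k] E} (hi : IsInjectiveEnvelope i)
    (N : Type u) [AddCommGroup N] [Module k N] [Module.Finite k N] :
    Module.Finite k (N →ₗ[k] E) := by
  induction ‹Module.Finite k N› using
    IsNoetherianRing.induction_on_isQuotientEquivQuotientPrime k with
  | subsingleton N =>
    have : Subsingleton (N →ₗ[k] E) := ⟨fun f g => by
      ext x
      rw [Subsingleton.elim x 0, map_zero, map_zero]⟩
    infer_instance
  | quotient N p e =>
    have hmax : p.1.IsMaximal := inferInstance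
    have : IsSimpleModule k (k ⧸ p.1) := isSimpleModule_iff_isCoatom.2 hmax.out
    have : IsSimpleModule k N := IsSimpleModule.congr e
    have hle : ∀ (f : N →ₗ[k] E) (x : N), f x ∈ LinearMap.range i := by
      intro f x
      by_contra hx
      have h1 : (LinearMap.range i).comap f = ⊥ :=
        (eq_bot_or_eq_top _).resolve_right fun h => hx (by
          have : x ∈ (LinearMap.range i).comap f := h ▸ Submodule.mem_top
          exact this)
      have h2 := hi.essential (LinearMap.range f) (by
        rw [Submodule.eq_bot_iff]
        rintro _ ⟨⟨y, rfl⟩, hy⟩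
        have : y ∈ (LinearMap.range i).comap f := hy
        rw [h1] at this
        simp [(Submodule.mem_bot k).1 this])
      rw [LinearMap.range_eq_bot] at h2
      exact hx (by simp [h2])
    have hgen : ∀ x : N, ∃ c : k, x = c • e.symm 1 := fun x => by
      obtain ⟨c, hc⟩ := Ideal.Quotient.mk_surjective (e x)
      refine ⟨c, e.injective ?_⟩
      rw [map_smul, e.apply_symm_apply, ← hc, Algebra.smul_def, mul_one]
      rfl
    let ev : (N →ₗ[k] E) →ₗ[k] LinearMap.range i :=
      LinearMap.codRestrict _ (LinearMap.applyₗ (e.symm 1)) fun f => hle f _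
    refine Module.Finite.of_injective ev fun f g hfg => ?_
    ext x
    obtain ⟨c, rfl⟩ := hgen x
    rw [map_smul, map_smul]
    exact congrArg _ (congrArg Subtype.val hfg)
  | exact N₁ N₂ N₃ f g hf hg hfg h₁ h₃ =>
    have := isNoetherian_of_isNoetherianRing_of_finite k (N₁ →ₗ[k] E)
    have := isNoetherian_of_isNoetherianRing_of_finite k (N₃ →ₗ[k] E)
    have := isNoetherian_of_range_eq_ker (LinearMap.lcomp k E g) (LinearMap.lcomp k E f) (by
      ext φ
      exact (LinearMap.exact_lcomp_of_exact_of_surjective E hfg hg φ).symm)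
    infer_instance

/-- `R` is an artin algebra over `k`: the commutative ring `k` is artinian and the `k`-algebra `R`
is finitely generated as a `k`-module. (`outParam` only helps instance search to find `k`.) -/
class IsArtinAlgebra (k : outParam (Type u)) (R : Type u) [CommRing k] [Ring R] [Algebra k R] :
    Prop where
  isArtinianRing : IsArtinianRing k
  finite : Module.Finite k R

section
variable (k R : Type u) [CommRing k] [Ring R] [Algebra k R] [IsArtinAlgebra k R]

instance IsArtinAlgebra.isNoetherianRing : IsNoetherianRing R :=
  haveI := IsArtinAlgebra.isArtinianRing (k := k) (R := R)
  haveI := IsArtinAlgebra.finite (k := k) (R := R)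
  IsNoetherianRing.of_finite k R

instance IsArtinAlgebra.mulOpposite : IsArtinAlgebra k Rᵐᵒᵖ where
  isArtinianRing := IsArtinAlgebra.isArtinianRing (k := k) (R := R)
  finite :=
    haveI := IsArtinAlgebra.finite (k := k) (R := R)
    Module.Finite.equiv (MulOpposite.opLinearEquiv k)
end

/-- The injective envelope `E` of the `k`-module `k / rad k`. -/
def dualizingModule (k : Type u) [CommRing k] : ModuleCat.{u} k :=
  (exists_isInjectiveEnvelope k (k ⧸ Ring.jacobson k)).choose

theorem dualizingModule_spec (k : Type u) [CommRing k] :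
    ∃ i : (k ⧸ Ring.jacobson k) →ₗ[k] dualizingModule k, IsInjectiveEnvelope i :=
  (exists_isInjectiveEnvelope k (k ⧸ Ring.jacobson k)).choose_spec

section Dual

variable {k R S : Type u} [CommRing k] [Ring R] [Algebra k R] [Ring S] [Algebra k S]
  (σ : S ≃ₐ[k] Rᵐᵒᵖ)

/-- The dual `D M = Hom_k(M, E)` of a left `R`-module `M`, for the underlying `k`-module of `M`.
It is a right `R`-module by `(f r) x = f (r x)`, that is, a left module over any algebra `S` which
is identified with the opposite algebra of `R` by `σ`. -/
def DualModule (_σ : S ≃ₐ[k] Rᵐᵒᵖ) (M : Type u) [AddCommGroup M] [Module R M] : Type u :=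
  RestrictScalars k R M →ₗ[k] dualizingModule k

namespace DualModule

section

variable (M : Type u) [AddCommGroup M] [Module R M]

instance : AddCommGroup (DualModule σ M) :=
  inferInstanceAs (AddCommGroup (RestrictScalars k R M →ₗ[k] dualizingModule k))

instance : Module k (DualModule σ M) :=
  inferInstanceAs (Module k (RestrictScalars k R M →ₗ[k] dualizingModule k))

end

variable {M N : Type u} [AddCommGroup M] [Module R M] [AddCommGroup N] [Module R N]

variable {σ} in
/-- The linear map underlying an element of the dual. -/
def toLin (f : DualModule σ M) : RestrictScalars k R M →ₗ[k] dualizingModule k := f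

instance : FunLike (DualModule σ M) M (dualizingModule k) where
  coe f x := f.toLin x
  coe_injective _ _ h := LinearMap.ext (congrFun h)

theorem ext {f g : DualModule σ M} (h : ∀ x, f x = g x) : f = g := DFunLike.ext _ _ h

instance : AddMonoidHomClass (DualModule σ M) M (dualizingModule k) where
  map_add f := f.toLin.map_add
  map_zero f := f.toLin.map_zero

theorem map_algebraMap_smul (f : DualModule σ M) (c : k) (x : M) :
    f (algebraMap k R c • x) = c • f x :=
  f.toLin.map_smul c x

instance : SMul S (DualModule σ M) where
  smul s f := f.toLin ∘ₗ RestrictScalars.lsmul k R M (σ s).unop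

theorem smul_apply (s : S) (f : DualModule σ M) (x : M) : (s • f) x = f ((σ s).unop • x) :=
  rfl

instance : Module S (DualModule σ M) where
  one_smul f := ext σ fun x => by
    rw [smul_apply, map_one, MulOpposite.unop_one, one_smul]
  mul_smul s t f := ext σ fun x => by
    rw [smul_apply, smul_apply, smul_apply, map_mul, MulOpposite.unop_mul, mul_smul]
  smul_zero _ := rfl
  smul_add _ _ _ := rfl
  add_smul s t f := ext σ fun x => by
    rw [smul_apply, map_add, MulOpposite.unop_add, add_smul, map_add]
    rfl
  zero_smul f := ext σ fun x => by
    rw [smul_apply, map_zero, MulOpposite.unop_zero, zero_smul, map_zero]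
    rfl

instance : IsScalarTower k S (DualModule σ M) where
  smul_assoc c s f := ext σ fun x => by
    change f ((σ (c • s)).unop • x) = c • f ((σ s).unop • x)
    rw [map_smul σ, MulOpposite.unop_smul, Algebra.smul_def, mul_smul, map_algebraMap_smul]

instance [IsArtinAlgebra k R] [Module.Finite R M] : Module.Finite S (DualModule σ M) := by
  have := IsArtinAlgebra.isArtinianRing (k := k) (R := R)
  have := IsArtinAlgebra.finite (k := k) (R := R)
  let _ : Module k M := Module.restrictScalars k R M
  have : IsScalarTower k R M := IsScalarTower.restrictScalars k R M
  have : Module.Finite k M := Module.Finite.trans R M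
  obtain ⟨i, hi⟩ := dualizingModule_spec k
  have : Module.Finite k (DualModule σ M) := hi.finite_hom M
  exact Module.Finite.of_restrictScalars_finite k S _

/-- The map `f ↦ f ∘ φ`. -/
def map (φ : M →ₗ[R] N) : DualModule σ N →ₗ[S] DualModule σ M where
  toFun f := f.toLin ∘ₗ (show RestrictScalars k R M →ₗ[k] RestrictScalars k R N from
    { toFun := φ
      map_add' := φ.map_add
      map_smul' := fun c x => φ.map_smul (algebraMap k R c) x })
  map_add' _ _ := rfl
  map_smul' _ f := ext σ fun x => congrArg f (φ.map_smul _ x).symm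

theorem map_apply (φ : M →ₗ[R] N) (f : DualModule σ N) (x : M) : map σ φ f x = f (φ x) := rfl

/-- The dual of an exact sequence is exact, by injectivity of the dualizing module. -/
theorem exists_map_eq {P : Type u} [AddCommGroup P] [Module R P] (φ : M →ₗ[R] N) (ψ : N →ₗ[R] P)
    (h : ∀ x, ψ x = 0 → ∃ y, φ y = x) (f : DualModule σ N) (hf : map σ φ f = 0) :
    ∃ g : DualModule σ P, map σ ψ g = f := by
  let _ : Module k N := Module.restrictScalars k R N
  let _ : Module k P := Module.restrictScalars k R P
  let ψ' : N →ₗ[k] P :=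
    { toFun := ψ
      map_add' := ψ.map_add
      map_smul' := fun c x => ψ.map_smul (algebraMap k R c) x }
  let f' : N →ₗ[k] dualizingModule k := f
  have hker : LinearMap.ker ψ' ≤ LinearMap.ker f' := fun x hx => by
    obtain ⟨y, rfl⟩ := h x hx
    exact DFunLike.congr_fun hf y
  obtain ⟨i, hi⟩ := dualizingModule_spec k
  obtain ⟨g, hg⟩ := hi.injective_module.out (LinearMap.range ψ').subtype
    (Submodule.subtype_injective _)
    ((LinearMap.ker ψ').liftQ f' hker ∘ₗ ψ'.quotKerEquivRange.symm.toLinearMap)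
  refine ⟨g, ext σ fun x => (hg ⟨ψ' x, x, rfl⟩).trans ?_⟩
  have : ψ'.quotKerEquivRange.symm ⟨ψ' x, x, rfl⟩ = (LinearMap.ker ψ').mkQ x := by
    rw [LinearEquiv.symm_apply_eq]
    rfl
  rw [LinearMap.comp_apply, LinearEquiv.coe_coe, this]
  rfl

end DualModule

open Opposite

/-- The usual duality `D = Hom_k(-, E)` from finitely generated left `R`-modules to finitely
generated left modules over the opposite algebra `S` of `R`. -/
@[simps]
def dualFunctor [IsArtinAlgebra k R] : (FGModuleCat.{u} R)ᵒᵖ ⥤ FGModuleCat.{u} S where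
  obj M := FGModuleCat.of S (DualModule σ M.unop)
  map f := FGModuleCat.ofHom (DualModule.map σ f.unop.hom.hom)

instance [IsArtinAlgebra k R] : (dualFunctor σ).Additive where
  map_add {M N f g} := by
    ext φ
    exact DualModule.ext σ fun x => map_add (show DualModule σ M.unop from φ) _ _

theorem exact_fgModuleCat_iff {A : Type u} [Ring A] [IsNoetherianRing A]
    (X : ShortComplex (FGModuleCat.{u} A)) :
    X.Exact ↔ ∀ x, X.g.hom.hom x = 0 → ∃ y, X.f.hom.hom y = x := by
  rw [← ShortComplex.exact_map_iff_of_faithful X (forget₂ (FGModuleCat.{u} A) (ModuleCat.{u} A)),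
    ShortComplex.moduleCat_exact_iff]
  rfl

instance [IsArtinAlgebra k R] [IsNoetherianRing S] : (dualFunctor σ).PreservesHomology := by
  refine Functor.preservesHomology_of_map_exact _ fun X hX => ?_
  rw [← ShortComplex.exact_unop_iff, exact_fgModuleCat_iff] at hX
  rw [exact_fgModuleCat_iff]
  exact fun φ hφ => DualModule.exists_map_eq σ X.unop.f.hom.hom X.unop.g.hom.hom hX φ hφ

end Dual

section Derived

open Opposite Limits

variable {C : Type u} [Category.{v} C] [Abelian C] {C' : Type u'} [Category.{v'} C'] [Abelian C']

theorem quasiIso_opEquivalence_map {K L : CochainComplex C ℤ} (f : K ⟶ L)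
    [hf : QuasiIso f] : QuasiIso ((CochainComplex.opEquivalence C).functor.map f.op) := by
  rw [quasiIso_iff] at hf ⊢
  intro n
  have h := hf (-n)
  rw [quasiIsoAt_iff' _ (-(n + 1)) (-n) (-(n - 1)) (by simp; lia) (by simp; lia)] at h
  rw [quasiIsoAt_iff' _ (n - 1) n (n + 1) (by simp) (by simp)]
  exact (ShortComplex.quasiIso_opMap_iff _).2 h

section

variable (F : Cᵒᵖ ⥤ C') [F.Additive]

/-- A contravariant functor `F` applied to complexes: the term of degree `n` is `F (K⁻ⁿ)`. -/
def contraMapComplex : (CochainComplex C ℤ)ᵒᵖ ⥤ CochainComplex C' ℤ :=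
  (CochainComplex.opEquivalence C).functor ⋙ F.mapHomologicalComplex (ComplexShape.up ℤ)

variable [F.PreservesHomology] [HasDerivedCategory.{w'} C']

theorem contraMapComplex_isInvertedBy :
    (HomologicalComplex.quasiIso C (ComplexShape.up ℤ)).op.IsInvertedBy
      (contraMapComplex F ⋙ DerivedCategory.Q) := by
  intro K L f (hf : QuasiIso f.unop)
  have : QuasiIso ((CochainComplex.opEquivalence C).functor.map f) :=
    quasiIso_opEquivalence_map f.unop
  have : QuasiIso ((contraMapComplex F).map f) :=
    HomologicalComplex.quasiIso_map_of_preservesHomology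
      ((CochainComplex.opEquivalence C).functor.map f) F
  exact inferInstanceAs (IsIso (DerivedCategory.Q.map ((contraMapComplex F).map f)))

variable [HasDerivedCategory.{w} C]

/-- The functor on derived categories induced by an exact contravariant functor. -/
def contraMapDerived : (DerivedCategory C)ᵒᵖ ⥤ DerivedCategory C' :=
  Localization.lift (contraMapComplex F ⋙ DerivedCategory.Q)
    (contraMapComplex_isInvertedBy F) DerivedCategory.Q.op

/-- The functor on derived categories is induced by the functor on complexes. -/
def contraMapDerivedFactors :
    DerivedCategory.Q.op ⋙ contraMapDerived F ≅ contraMapComplex F ⋙ DerivedCategory.Q :=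
  Localization.fac _ (contraMapComplex_isInvertedBy F) DerivedCategory.Q.op

/-- The functor on bounded derived categories induced by an exact contravariant functor. -/
def contraMapBounded :
    (DerivedCategory.Bounded C)ᵒᵖ ⥤ DerivedCategory.Bounded C' :=
  ObjectProperty.lift _ (DerivedCategory.Bounded.ι.op ⋙ contraMapDerived F) (by
    rintro ⟨X, ⟨a, ha⟩, ⟨b, hb⟩⟩
    obtain ⟨K, _, _, ⟨e⟩⟩ := DerivedCategory.exists_iso_Q_obj_of_isGE_of_isLE X a b
    let e' : (contraMapDerived F).obj (op X) ≅ 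
        DerivedCategory.Q.obj ((contraMapComplex F).obj (op K)) :=
      (contraMapDerived F).mapIso e.symm.op ≪≫ (contraMapDerivedFactors F).app (op K)
    have hz : ∀ n : ℤ, IsZero (K.X (-n)) → IsZero (((contraMapComplex F).obj (op K)).X n) :=
      fun n h => F.map_isZero h.op
    have h₁ : ((contraMapComplex F).obj (op K)).IsStrictlyGE (-b) := by
      rw [CochainComplex.isStrictlyGE_iff]
      exact fun n hn => hz n (K.isZero_of_isStrictlyLE b (-n) (by lia))
    have h₂ : ((contraMapComplex F).obj (op K)).IsStrictlyLE (-a) := by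
      rw [CochainComplex.isStrictlyLE_iff]
      exact fun n hn => hz n (K.isZero_of_isStrictlyGE a (-n) (by lia))
    exact ⟨⟨-b, ⟨_, e', h₁⟩⟩, ⟨-a, ⟨_, e', h₂⟩⟩⟩)

end

variable [HasDerivedCategory.{w} C]

/-- An object of `C` as a stalk complex in degree `0`. -/
def stalk (X : C) : DerivedCategory.Bounded C :=
  ⟨(DerivedCategory.singleFunctor C 0).obj X,
    ⟨0, inferInstanceAs (((DerivedCategory.singleFunctor C 0).obj X).IsGE 0)⟩,
    ⟨0, inferInstanceAs (((DerivedCategory.singleFunctor C 0).obj X).IsLE 0)⟩⟩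

/-- The complexes whose cohomology is concentrated in the interval `[a, b]`. -/
def cohomologyIn (a b : ℤ) : ObjectProperty (DerivedCategory.Bounded C) := fun X =>
  ∀ n : ℤ, n ∉ Set.Icc a b → IsZero ((DerivedCategory.homologyFunctor C n).obj X.obj)

/-- The complexes `N` with `Hom(M, N[i]) = 0` for all `i > 0`. -/
def rightPerp (M : DerivedCategory.Bounded C) : ObjectProperty (DerivedCategory.Bounded C) :=
  fun N => ∀ i : ℤ, 0 < i → ∀ f : M ⟶ N⟦i⟧, f = 0

/-- The complexes `N` with `Hom(N, M[i]) = 0` for all `i > 0`. -/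
def leftPerp (M : DerivedCategory.Bounded C) : ObjectProperty (DerivedCategory.Bounded C) :=
  fun N => ∀ i : ℤ, 0 < i → ∀ f : N ⟶ M⟦i⟧, f = 0

/-- `Hom(M, M[i]) = 0` for all `i > 0`. -/
def IsSemiSelforthogonal (M : DerivedCategory.Bounded C) : Prop := rightPerp M M

/-- The direct summands of finite direct sums of copies of `M`. -/
def addClosure (M : DerivedCategory.Bounded C) : ObjectProperty (DerivedCategory.Bounded C) :=
  fun N => ∃ (n : ℕ) (N' : DerivedCategory.Bounded C), Nonempty (N ⊞ N' ≅ ⨁ fun _ : Fin n => M)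

/-- There is a distinguished triangle `X ⟶ Y ⟶ Z ⟶ X[1]`. -/
def HasTriangle (X Y Z : DerivedCategory.Bounded C) : Prop :=
  ∃ (f : X ⟶ Y) (g : Y ⟶ Z) (h : Z ⟶ X⟦(1 : ℤ)⟧),
    Pretriangulated.Triangle.mk f g h ∈ Pretriangulated.distinguishedTriangles

/-- The class `_M 𝒳^I` for `I = [a, b]`: there are triangles `X_{i+1} ⟶ M_i ⟶ X_i ⟶` for all
`i ≥ 0` with `X_0 = X`, all `M_i` in `add M`, and all `X_i` right orthogonal to `M` with cohomology
in `I`. -/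
def auslanderClassOn (M : DerivedCategory.Bounded C) (a b : ℤ) :
    ObjectProperty (DerivedCategory.Bounded C) := fun X =>
  ∃ Y N : ℕ → DerivedCategory.Bounded C, Y 0 = X ∧ ∀ i : ℕ,
    HasTriangle (Y (i + 1)) (N i) (Y i) ∧ addClosure M (N i) ∧ rightPerp M (Y i) ∧
      cohomologyIn a b (Y i)

/-- The class `𝒳_M^I` for `I = [a, b]`: there are triangles `X_i ⟶ M_i ⟶ X_{i+1} ⟶` for all
`i ≥ 0` with `X_0 = X`, all `M_i` in `add M`, and all `X_i` left orthogonal to `M` with cohomology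
in `I`. -/
def coAuslanderClassOn (M : DerivedCategory.Bounded C) (a b : ℤ) :
    ObjectProperty (DerivedCategory.Bounded C) := fun X =>
  ∃ Y N : ℕ → DerivedCategory.Bounded C, Y 0 = X ∧ ∀ i : ℕ,
    HasTriangle (Y i) (N i) (Y (i + 1)) ∧ addClosure M (N i) ∧ leftPerp M (Y i) ∧
      cohomologyIn a b (Y i)

/-- The Auslander class `_M 𝒳^♭`. -/
def auslanderClass (M : DerivedCategory.Bounded C) :
    ObjectProperty (DerivedCategory.Bounded C) := fun X =>
  ∃ a b : ℤ, cohomologyIn a b M ∧ auslanderClassOn M a b X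

/-- The co-Auslander class `𝒳_M^♭`. -/
def coAuslanderClass (M : DerivedCategory.Bounded C) :
    ObjectProperty (DerivedCategory.Bounded C) := fun X =>
  ∃ a b : ℤ, cohomologyIn a b M ∧ coAuslanderClassOn M a b X

/-- `⟨P⟩_+`: the complexes isomorphic to `Z[n]` with `Z` in `P` and `n ≥ 0`. -/
def nonnegShifts (P : ObjectProperty (DerivedCategory.Bounded C)) :
    ObjectProperty (DerivedCategory.Bounded C) := fun X =>
  ∃ (n : ℤ) (Z : DerivedCategory.Bounded C), 0 ≤ n ∧ P Z ∧ Nonempty (X ≅ Z⟦n⟧)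

/-- `⟨P⟩_-`: the complexes isomorphic to `Z[n]` with `Z` in `P` and `n ≤ 0`. -/
def nonposShifts (P : ObjectProperty (DerivedCategory.Bounded C)) :
    ObjectProperty (DerivedCategory.Bounded C) := fun X =>
  ∃ (n : ℤ) (Z : DerivedCategory.Bounded C), n ≤ 0 ∧ P Z ∧ Nonempty (X ≅ Z⟦n⟧)

end Derived

section Silting

open Opposite

/-- `T` in `D^b(mod R)` is Wakamatsu-silting: it is semi-selforthogonal and the left regular module
`R` lies in `⟨𝒳_T^♭⟩_+`. -/
def IsWakamatsuSilting (R : Type u) [Ring R] [IsNoetherianRing R]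
    [HasDerivedCategory.{w} (FGModuleCat.{u} R)]
    (T : DerivedCategory.Bounded (FGModuleCat.{u} R)) : Prop :=
  IsSemiSelforthogonal T ∧ nonnegShifts (coAuslanderClass T) (stalk (FGModuleCat.of R R))

variable (k R : Type u) [CommRing k] [Ring R] [Algebra k R] [IsArtinAlgebra k R]

/-- The left `R`-module `DR`: the dual of the right regular module `R`, that is, of the left
regular module of the opposite algebra. -/
def dualRegular : FGModuleCat.{u} R :=
  (dualFunctor (AlgEquiv.opOp k R)).obj (op (FGModuleCat.of Rᵐᵒᵖ Rᵐᵒᵖ))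

/-- The duality `D : D^b(mod R) ⥤ D^b(mod Rᵒᵖ)`, contravariant, induced by `D = Hom_k(-, E)`. -/
def derivedDual [HasDerivedCategory.{w} (FGModuleCat.{u} R)]
    [HasDerivedCategory.{w'} (FGModuleCat.{u} Rᵐᵒᵖ)] :
    (DerivedCategory.Bounded (FGModuleCat.{u} R))ᵒᵖ ⥤
      DerivedCategory.Bounded (FGModuleCat.{u} Rᵐᵒᵖ) :=
  contraMapBounded (dualFunctor (AlgEquiv.refl : Rᵐᵒᵖ ≃ₐ[k] Rᵐᵒᵖ))

end Silting

end

end WakamatsuSilting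

open WakamatsuSilting

/-!
The regular module `R` detects cohomology, `Hⁿ X = 0 ↔ Hom(R, X[n]) = 0`, and `DR` codetects it,
`Hⁿ X = 0 ↔ Hom(X, DR[-n]) = 0`. Suppose that a shift of `R` is coresolved by the objects `Xᵢ` of
a bounded interval, with terms in `add T`. A sufficiently high shift of `DR` is right orthogonal to
`T` and to all `Xᵢ`. Since Hom spaces are finitely generated over `k`, every object has a right
`add T`-approximation, and both orthogonality conditions pass to the cocone of such an
approximation: a morphism from `Xᵢ` to the approximated object extends along `Xᵢ → Tᵢ`, because
`Xᵢ₊₁` is orthogonal to that object, and hence lifts to the approximation. Orthogonality to `X₀`, a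
shift of `R`, bounds the cohomology of all iterated cocones from above; a lower bound is automatic.
So iterating approximations puts a shift of `DR` in the Auslander class, which is (1) ⇒ (2). The
duality exchanges Auslander and co-Auslander classes, which gives (2) ⇒ (3), and (3) ⇒ (1) is
(1) ⇒ (2) over `Rᵒᵖ` carried back along the duality.
-/

namespace WakamatsuSilting

open Limits Pretriangulated Opposite

section HomVanishes

variable {𝒯 : Type u} [Category.{v} 𝒯] [Preadditive 𝒯] [HasShift 𝒯 ℤ]

/-- The vanishing of `Hom(X, Y[n])`. -/
def HomVanishes (X Y : 𝒯) (n : ℤ) : Prop := ∀ f : X ⟶ Y⟦n⟧, f = 0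

namespace HomVanishes

variable {X X' Y Y' Z W : 𝒯} {n m : ℤ}

theorem of_iso (h : HomVanishes X Y n) (e : X ≅ X') (e' : Y ≅ Y') : HomVanishes X' Y' n := by
  intro f
  rw [← cancel_epi e.hom, ← cancel_mono (e'.inv⟦n⟧'), Category.assoc,
    h (e.hom ≫ f ≫ e'.inv⟦n⟧'), comp_zero, zero_comp]

theorem zero_iff : HomVanishes X Y 0 ↔ ∀ f : X ⟶ Y, f = 0 := by
  let e : Y⟦(0 : ℤ)⟧ ≅ Y := (shiftFunctorZero 𝒯 ℤ).app Y
  constructor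
  · intro h f
    rw [← cancel_mono e.inv, zero_comp]
    exact h _
  · intro h f
    rw [← cancel_mono e.hom, zero_comp]
    exact h _

theorem shift_right_iff (a : ℤ) (hm : a + n = m) :
    HomVanishes X (Y⟦a⟧) n ↔ HomVanishes X Y m := by
  let e : Y⟦m⟧ ≅ Y⟦a⟧⟦n⟧ := (shiftFunctorAdd' _ a n m hm).app Y
  constructor
  · intro h f
    rw [← cancel_mono e.hom, zero_comp]
    exact h _
  · intro h f
    rw [← cancel_mono e.inv, zero_comp]
    exact h _

variable [∀ n : ℤ, (shiftFunctor 𝒯 n).Additive]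

theorem shift_shift_iff (a : ℤ) : HomVanishes (X⟦a⟧) (Y⟦a⟧) n ↔ HomVanishes X Y n := by
  let e : Y⟦n⟧⟦a⟧ ≅ Y⟦a⟧⟦n⟧ := shiftComm Y n a
  constructor
  · intro h f
    refine (shiftFunctor _ a).map_injective ?_
    rw [← cancel_mono e.hom, h (f⟦a⟧' ≫ e.hom), Functor.map_zero, zero_comp]
  · intro h f
    obtain ⟨g, hg⟩ := (shiftFunctor _ a).map_surjective (f ≫ e.inv)
    rw [← cancel_mono e.inv, zero_comp, ← hg, h g, Functor.map_zero]

theorem shift_left_iff (a : ℤ) (hm : a + m = n) :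
    HomVanishes (X⟦a⟧) Y n ↔ HomVanishes X Y m := by
  rw [← shift_shift_iff (X := X) a, shift_right_iff a hm]

variable [HasZeroObject 𝒯] [Pretriangulated 𝒯] {T : Triangle 𝒯}

theorem obj₂ (hT : T ∈ distTriang 𝒯) (h₁ : HomVanishes W T.obj₁ n)
    (h₃ : HomVanishes W T.obj₃ n) : HomVanishes W T.obj₂ n := by
  intro φ
  obtain ⟨ψ, rfl⟩ := Triangle.coyoneda_exact₂ _ (Triangle.shift_distinguished _ hT n) φ (h₃ _)
  obtain rfl : ψ = 0 := h₁ ψ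
  exact zero_comp

theorem obj₁ (hT : T ∈ distTriang 𝒯) (hm : n + 1 = m) (h₃ : HomVanishes W T.obj₃ n)
    (h₂ : HomVanishes W T.obj₂ m) : HomVanishes W T.obj₁ m := by
  have h₂' : HomVanishes W (T.obj₂⟦(1 : ℤ)⟧) n := (shift_right_iff 1 (by lia)).2 h₂
  exact (shift_right_iff 1 (by lia)).1
    (obj₂ (rot_of_distTriang _ (rot_of_distTriang _ hT)) h₃ h₂')

theorem obj₁_of_lift (hT : T ∈ distTriang 𝒯)
    (hlift : ∀ φ : W ⟶ T.obj₃, ∃ ψ : W ⟶ T.obj₂, ψ ≫ T.mor₂ = φ)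
    (h₂ : HomVanishes W T.obj₂ 1) : HomVanishes W T.obj₁ 1 := by
  intro φ
  obtain ⟨ψ, rfl⟩ := Triangle.coyoneda_exact₁ _ hT φ (h₂ _)
  obtain ⟨χ, rfl⟩ := hlift ψ
  rw [Category.assoc, comp_distTriang_mor_zero₂₃ _ hT, comp_zero]

theorem exists_extension (hT : T ∈ distTriang 𝒯) (h₃ : HomVanishes T.obj₃ W 1)
    (φ : T.obj₁ ⟶ W) : ∃ ψ : T.obj₂ ⟶ W, T.mor₁ ≫ ψ = φ := by
  have h₃' : HomVanishes (T.obj₃⟦(-1 : ℤ)⟧) W 0 := (shift_left_iff (-1) (by lia)).2 h₃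
  obtain ⟨ψ, hψ⟩ := Triangle.yoneda_exact₂ _ (inv_rot_of_distTriang _ hT) φ (zero_iff.1 h₃' _)
  exact ⟨ψ, hψ.symm⟩

end HomVanishes

end HomVanishes

theorem exists_seq_of_forall_exists {α : Type*} {S : α → Prop} {r : α → α → Prop}
    (h : ∀ x, S x → ∃ y, S y ∧ r x y) {x : α} (hx : S x) :
    ∃ u : ℕ → α, u 0 = x ∧ ∀ n, S (u n) ∧ r (u n) (u (n + 1)) := by
  choose next hnext hr using h
  let u : ℕ → {x // S x} := fun n => (fun y => ⟨next y y.2, hnext y y.2⟩)^[n] ⟨x, hx⟩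
  refine ⟨fun n => u n, rfl, fun n => ⟨(u n).2, ?_⟩⟩
  simp only [u, Function.iterate_succ_apply']
  exact hr _ _

section Approximation

variable {C : Type u} [Category.{v} C] [Abelian C] [HasDerivedCategory.{w} C]
  {M N N' X Y : DerivedCategory.Bounded C}

theorem addClosure.exists_sum_eq_id (h : addClosure M N) :
    ∃ (n : ℕ) (f : Fin n → (N ⟶ M)) (g : Fin n → (M ⟶ N)), ∑ i, f i ≫ g i = 𝟙 N := by
  obtain ⟨n, N', ⟨e⟩⟩ := h
  refine ⟨n, fun i => biprod.inl ≫ e.hom ≫ biproduct.π _ i,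
    fun i => biproduct.ι (fun _ : Fin n => M) i ≫ e.inv ≫ biprod.fst, ?_⟩
  have htotal : ∑ i, biproduct.π (fun _ : Fin n => M) i ≫
      biproduct.ι (fun _ : Fin n => M) i = 𝟙 _ := biproduct.total
  calc _ = biprod.inl ≫ e.hom ≫ (∑ i, biproduct.π (fun _ : Fin n => M) i ≫
        biproduct.ι (fun _ : Fin n => M) i) ≫ e.inv ≫ biprod.fst := by
        simp only [Preadditive.comp_sum, Preadditive.sum_comp, Category.assoc]
    _ = _ := by rw [htotal]; simp

theorem addClosure.of_sum_eq_id {n : ℕ} (f : Fin n → (N ⟶ M)) (g : Fin n → (M ⟶ N))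
    (hfg : ∑ i, f i ≫ g i = 𝟙 N) : addClosure M N := by
  let i : N ⟶ ⨁ fun _ : Fin n => M := biproduct.lift f
  have hi : i ≫ biproduct.desc g = 𝟙 N := biproduct.lift_desc.trans hfg
  obtain ⟨Z, q, δ, hT⟩ := distinguished_cocone_triangle i
  have : Mono i := mono_of_mono_fac hi
  have hδ : δ = 0 := (Triangle.mor₃_eq_zero_iff_mono₁ _ hT).2 this
  obtain ⟨e, -⟩ := exists_iso_binaryBiproduct_of_distTriang _ hT hδ
  exact ⟨n, Z, ⟨e.symm⟩⟩

theorem addClosure_biproduct (M : DerivedCategory.Bounded C) (n : ℕ) :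
    addClosure M (⨁ fun _ : Fin n => M) :=
  .of_sum_eq_id (biproduct.π _) (biproduct.ι fun _ => M) biproduct.total

theorem HomVanishes.of_addClosure {n : ℤ} (h : HomVanishes X M n) (hN : addClosure M N) :
    HomVanishes X N n := by
  obtain ⟨m, f, g, hfg⟩ := hN.exists_sum_eq_id
  intro φ
  rw [← Category.comp_id φ, ← CategoryTheory.Functor.map_id, ← hfg,
    Functor.map_sum, Preadditive.comp_sum]
  refine Finset.sum_eq_zero fun i _ => ?_
  rw [Functor.map_comp, ← Category.assoc, h (φ ≫ (f i)⟦n⟧'), zero_comp]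

/-- `f : N ⟶ Y` is a right `add M`-approximation: `N` lies in `add M` and every morphism
`M ⟶ Y` factors through `f`. -/
def IsRightApproximation (M : DerivedCategory.Bounded C) {N Y : DerivedCategory.Bounded C}
    (f : N ⟶ Y) : Prop :=
  addClosure M N ∧ ∀ g : M ⟶ Y, ∃ h : M ⟶ N, h ≫ f = g

/-- `add M` is contravariantly finite: every object has a right `add M`-approximation. -/
def IsContravariantlyFinite (M : DerivedCategory.Bounded C) : Prop :=
  ∀ Y : DerivedCategory.Bounded C, ∃ (N : DerivedCategory.Bounded C) (f : N ⟶ Y),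
    IsRightApproximation M f

theorem IsRightApproximation.exists_lift {f : N ⟶ Y} (hf : IsRightApproximation M f)
    (hN' : addClosure M N') (g : N' ⟶ Y) : ∃ h : N' ⟶ N, h ≫ f = g := by
  obtain ⟨m, p, q, hpq⟩ := hN'.exists_sum_eq_id
  choose h hh using fun i => hf.2 (q i ≫ g)
  refine ⟨∑ i, p i ≫ h i, ?_⟩
  calc (∑ i, p i ≫ h i) ≫ f = ∑ i, (p i ≫ q i) ≫ g := by
        simp only [Preadditive.sum_comp, Category.assoc, hh]
    _ = g := by rw [← Preadditive.sum_comp, hpq, Category.id_comp]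

end Approximation

section AuslanderClass

variable {C : Type u} [Category.{v} C] [Abelian C] [HasDerivedCategory.{w} C]
  {T X Y : DerivedCategory.Bounded C} {a b : ℤ}

theorem auslanderClassOn_of_invariant (S : ObjectProperty (DerivedCategory.Bounded C))
    (h : ∀ Y, S Y → rightPerp T Y ∧ cohomologyIn a b Y ∧
      ∃ Y' N, S Y' ∧ HasTriangle Y' N Y ∧ addClosure T N)
    (hX : S X) : auslanderClassOn T a b X := by
  obtain ⟨Y, hY₀, hY⟩ := exists_seq_of_forall_exists (S := S)
    (r := fun Y Y' => ∃ N, HasTriangle Y' N Y ∧ addClosure T N)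
    (fun Y hY => by
      obtain ⟨Y', N, hY', hN⟩ := (h Y hY).2.2
      exact ⟨Y', hY', N, hN⟩) hX
  choose N hN using fun i => (hY i).2
  exact ⟨Y, N, hY₀, fun i => ⟨(hN i).1, (hN i).2, (h _ (hY i).1).1, (h _ (hY i).1).2.1⟩⟩

end AuslanderClass

section CohomologyDetection

variable {C : Type u} [Category.{v} C] [Abelian C] [HasDerivedCategory.{w} C]
  {P J T W Y : DerivedCategory.Bounded C} {Δ : Triangle (DerivedCategory.Bounded C)}

theorem exists_cohomologyIn (X : DerivedCategory.Bounded C) : ∃ a b : ℤ, cohomologyIn a b X := by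
  obtain ⟨X, ⟨a, ha⟩, ⟨b, hb⟩⟩ := X
  refine ⟨a, b, fun n hn => ?_⟩
  rw [Set.mem_Icc, not_and_or, not_le, not_le] at hn
  exact hn.elim (fun h => DerivedCategory.isZero_of_isGE X a n h)
    (fun h => DerivedCategory.isZero_of_isLE X b n h)

theorem cohomologyIn.mono {a b a' b' : ℤ} (h : cohomologyIn a b Y) (ha : a' ≤ a) (hb : b ≤ b') :
    cohomologyIn a' b' Y :=
  fun n hn => h n fun hn' => hn ⟨ha.trans hn'.1, hn'.2.trans hb⟩

/-- `P` detects cohomology covariantly: `Hⁿ X = 0` if and only if `Hom(P, X[n]) = 0`. This is what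
the argument needs of the regular module `R`. -/
def DetectsCohomology (P : DerivedCategory.Bounded C) : Prop :=
  ∀ (X : DerivedCategory.Bounded C) (n : ℤ),
    IsZero ((DerivedCategory.homologyFunctor C n).obj X.obj) ↔ HomVanishes P X n

/-- `J` detects cohomology contravariantly: `Hⁿ X = 0` if and only if `Hom(X, J[-n]) = 0`. This is
what the argument needs of the injective cogenerator `DR`. -/
def CodetectsCohomology (J : DerivedCategory.Bounded C) : Prop :=
  ∀ (X : DerivedCategory.Bounded C) (n : ℤ),
    IsZero ((DerivedCategory.homologyFunctor C n).obj X.obj) ↔ HomVanishes X J (-n)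

theorem CodetectsCohomology.rightPerp_shift (hJ : CodetectsCohomology J) {a b m : ℤ}
    (hW : cohomologyIn a b W) (hm : -a ≤ m) : rightPerp W (J⟦m⟧) := by
  intro i hi
  have hHom : HomVanishes W J (- -(m + i)) := (hJ W _).1 (hW _ fun h => by have := h.1; lia)
  exact (HomVanishes.shift_right_iff m (by lia)).2 hHom

theorem rightPerp_of_lift (hΔ : Δ ∈ distTriang (DerivedCategory.Bounded C))
    (h₂ : rightPerp W Δ.obj₂) (h₃ : rightPerp W Δ.obj₃)
    (hlift : ∀ φ : W ⟶ Δ.obj₃, ∃ ψ : W ⟶ Δ.obj₂, ψ ≫ Δ.mor₂ = φ) : rightPerp W Δ.obj₁ := by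
  intro i hi
  obtain rfl | hi' : i = 1 ∨ 1 < i := by lia
  · exact HomVanishes.obj₁_of_lift hΔ hlift (h₂ 1 hi)
  · exact HomVanishes.obj₁ hΔ (n := i - 1) (by lia) (h₃ _ (by lia)) (h₂ i hi)

theorem IsRightApproximation.exists_lift_of_hasTriangle {N M W' : DerivedCategory.Bounded C}
    {f : N ⟶ Y} (hf : IsRightApproximation T f) (hW : HasTriangle W M W') (hM : addClosure T M)
    (hW' : HomVanishes W' Y 1) (φ : W ⟶ Y) : ∃ ψ : W ⟶ N, ψ ≫ f = φ := by
  obtain ⟨p, q, r, hpqr⟩ := hW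
  obtain ⟨ψ, rfl⟩ : ∃ ψ : M ⟶ Y, p ≫ ψ = φ := HomVanishes.exists_extension hpqr hW' φ
  obtain ⟨χ, rfl⟩ := hf.exists_lift hM ψ
  exact ⟨p ≫ χ, Category.assoc _ _ _⟩

theorem cohomologyIn_of_rightPerp (hP : DetectsCohomology P) {c d n : ℤ} (e : P ≅ W⟦n⟧)
    (hn : n ≤ d) (hW : rightPerp W Y) (hlow : ∀ j < c, HomVanishes P Y j) :
    cohomologyIn c d Y := by
  intro j hj
  rw [hP]
  by_cases hjc : j < c
  · exact hlow j hjc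
  · have hnj : 0 < j - n := by
      by_contra! h
      exact hj ⟨by lia, by lia⟩
    exact ((HomVanishes.shift_left_iff n (by lia)).2 (hW _ hnj)).of_iso e.symm (Iso.refl _)

/-- The objects obtained from `Y` by iterated cocones of approximations keep being right orthogonal
to the whole coresolution `X`, which is what bounds their cohomology above: `P` is a shift of
`X 0`. -/
theorem auslanderClassOn_of_coresolution (hP : DetectsCohomology P)
    (happ : IsContravariantlyFinite T) (hT : IsSemiSelforthogonal T)
    {X M : ℕ → DerivedCategory.Bounded C}
    (hX : ∀ l, HasTriangle (X l) (M l) (X (l + 1)) ∧ addClosure T (M l) ∧ leftPerp T (X l))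
    {c d n : ℤ} (e : P ≅ (X 0)⟦n⟧) (hn : n ≤ d) (hPT : ∀ j < c, HomVanishes P T j)
    (hTY : rightPerp T Y) (hXY : ∀ l, rightPerp (X l) Y) (hPY : ∀ j < c, HomVanishes P Y j) :
    auslanderClassOn T c d Y := by
  refine auslanderClassOn_of_invariant
    (fun Y => rightPerp T Y ∧ (∀ l, rightPerp (X l) Y) ∧ ∀ j < c, HomVanishes P Y j)
    ?_ ⟨hTY, hXY, hPY⟩
  rintro Y ⟨hTY, hXY, hPY⟩
  obtain ⟨N, f, hf⟩ := happ Y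
  obtain ⟨Y', g, δ, hΔ⟩ := distinguished_cocone_triangle₁ f
  have hTY' : rightPerp T Y' :=
    rightPerp_of_lift hΔ (fun i hi => HomVanishes.of_addClosure (hT i hi) hf.1) hTY hf.2
  have hXY' (l : ℕ) : rightPerp (X l) Y' :=
    rightPerp_of_lift hΔ (fun i hi => HomVanishes.of_addClosure ((hX l).2.2 i hi) hf.1) (hXY l)
      (hf.exists_lift_of_hasTriangle (hX l).1 (hX l).2.1 (hXY (l + 1) 1 one_pos))
  have hPY' (j : ℤ) (hj : j < c) : HomVanishes P Y' j :=
    .obj₁ hΔ (n := j - 1) (by lia) (hPY _ (by lia)) (.of_addClosure (hPT j hj) hf.1)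
  exact ⟨hTY, cohomologyIn_of_rightPerp hP e hn (hXY 0) hPY,
    Y', N, ⟨hTY', hXY', hPY'⟩, ⟨g, f, δ, hΔ⟩, hf.1⟩

theorem nonposShifts_auslanderClass_of_nonnegShifts_coAuslanderClass
    (hP : DetectsCohomology P) (hJ : CodetectsCohomology J) (happ : IsContravariantlyFinite T)
    (hT : IsSemiSelforthogonal T) (h : nonnegShifts (coAuslanderClass T) P) :
    nonposShifts (auslanderClass T) J := by
  obtain ⟨n, -, -, ⟨a, b, hTab, X, M, rfl, hX⟩, ⟨e⟩⟩ := h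
  obtain ⟨c, d, hJcd⟩ := exists_cohomologyIn J
  let m : ℤ := max 0 (-a)
  have hPT (j : ℤ) (hj : j < min a (c - m)) : HomVanishes P T j :=
    (hP T j).1 (hTab _ fun h => by have := h.1; lia)
  have hPJ (j : ℤ) (hj : j < min a (c - m)) : HomVanishes P (J⟦m⟧) j :=
    (HomVanishes.shift_right_iff m rfl).2 ((hP J _).1 (hJcd _ fun h => by have := h.1; lia))
  have hJm : auslanderClassOn T (min a (c - m)) (max b n) (J⟦m⟧) :=
    auslanderClassOn_of_coresolution hP happ hT
      (fun l => ⟨(hX l).1, (hX l).2.1, (hX l).2.2.1⟩) e (le_max_right _ _) hPT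
      (hJ.rightPerp_shift hTab (le_max_right _ _))
      (fun l => hJ.rightPerp_shift (hX l).2.2.2 (le_max_right _ _)) hPJ
  exact ⟨-m, J⟦m⟧, by lia, ⟨_, _, hTab.mono (min_le_left _ _) (le_max_left _ _), hJm⟩,
    ⟨(shiftEquiv _ m).unitIso.app J⟩⟩

end CohomologyDetection

section Projective

variable {C : Type u} [Category.{v} C] [Abelian C]

instance isKProjective_singleFunctor_obj (P : C) [Projective P] (n : ℤ) :
    ((CochainComplex.singleFunctor C n).obj P).IsKProjective := by
  have (i : ℤ) : Projective (((CochainComplex.singleFunctor C n).obj P).X i) := by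
    by_cases h : i = n
    · exact Projective.of_iso (HomologicalComplex.singleObjXIsoOfEq _ n P i h).symm ‹_›
    · exact (HomologicalComplex.isZero_single_obj_X _ n P i h).projective
  exact CochainComplex.isKProjective_of_projective _ n

theorem exists_single_hom_homologyMap_eq (P : C) [Projective P] (n : ℤ) (K : CochainComplex C ℤ)
    (φ : ((HomologicalComplex.single C (ComplexShape.up ℤ) n).obj P).homology n ⟶ K.homology n) :
    ∃ g : (HomologicalComplex.single C (ComplexShape.up ℤ) n).obj P ⟶ K,
      HomologicalComplex.homologyMap g n = φ := by
  obtain ⟨ψ, hψ⟩ : ∃ ψ : P ⟶ K.cycles n, ψ ≫ K.homologyπ n =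
      (HomologicalComplex.singleObjHomologySelfIso _ n P).inv ≫ φ :=
    ⟨_, Projective.factorThru_comp _ _⟩
  refine ⟨HomologicalComplex.mkHomFromSingle (ψ ≫ K.iCycles n) (fun k _ => by simp), ?_⟩
  rw [← cancel_epi (HomologicalComplex.singleObjHomologySelfIso _ n P).inv, ← hψ,
    ← HomologicalComplex.singleObjCyclesSelfIso_inv_homologyπ, Category.assoc,
    HomologicalComplex.homologyπ_naturality, ← Category.assoc]
  congr 1
  rw [← cancel_mono (K.iCycles n), Category.assoc, HomologicalComplex.cyclesMap_i,
    HomologicalComplex.singleObjCyclesSelfIso_inv_iCycles_assoc,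
    HomologicalComplex.mkHomFromSingle_f, Iso.inv_hom_id_assoc]

variable [HasDerivedCategory.{w} C]

theorem Q_map_surjective_of_isKProjective (K L : CochainComplex C ℤ) [K.IsKProjective] :
    Function.Surjective (DerivedCategory.Q.map : (K ⟶ L) → _) := by
  intro f
  obtain ⟨g', hg'⟩ := (CochainComplex.IsKProjective.Qh_map_bijective K _).surjective
    ((DerivedCategory.quotientCompQhIso C).hom.app K ≫ f ≫
      (DerivedCategory.quotientCompQhIso C).inv.app L)
  obtain ⟨g, rfl⟩ := (HomotopyCategory.quotient _ _).map_surjective g'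
  refine ⟨g, ?_⟩
  rw [← cancel_epi ((DerivedCategory.quotientCompQhIso C).hom.app K),
    ← DerivedCategory.quotientCompQhIso_hom_naturality, hg']
  simp

variable (P : C) [Projective P] (n : ℤ) {X : DerivedCategory C}

theorem eq_zero_of_isLE_of_projective {m : ℤ} [X.IsLE m] (hm : m < n)
    (f : (DerivedCategory.singleFunctor C n).obj P ⟶ X) : f = 0 := by
  obtain ⟨K, _, ⟨e⟩⟩ := DerivedCategory.exists_iso_Q_obj_of_isLE X m
  rw [← cancel_mono e.hom, zero_comp]
  exact DerivedCategory.from_singleFunctor_obj_eq_zero_of_projective _ m hm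

theorem eq_zero_of_isZero_homology (hX : IsZero ((DerivedCategory.homologyFunctor C n).obj X))
    (f : (DerivedCategory.singleFunctor C n).obj P ⟶ X) : f = 0 := by
  obtain ⟨X₁, X₂, h₁, h₂, i, p, δ, hT⟩ :=
    DerivedCategory.TStructure.t.exists_triangle X (n - 1) n (by lia)
  have : X₁.IsLE (n - 1) := ⟨h₁⟩
  have : X₂.IsGE n := ⟨h₂⟩
  have hX₂n : IsZero ((DerivedCategory.homologyFunctor C n).obj X₂) :=
    (DerivedCategory.HomologySequence.exact₃ _ hT n (n + 1) rfl).isZero_of_both_zeros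
      (hX.eq_of_src _ _) ((X₁.isZero_of_isLE (n - 1) (n + 1) (by lia)).eq_of_tgt _ _)
  have hX₂ : X₂.IsGE (n + 1) := by
    rw [DerivedCategory.isGE_iff]
    intro j hj
    obtain rfl | hj' : j = n ∨ j < n := by lia
    · exact hX₂n
    · exact X₂.isZero_of_isGE n j hj'
  have hfp : f ≫ p = 0 := DerivedCategory.TStructure.t.zero _ n (n + 1)
  obtain ⟨g, hg⟩ : ∃ g : _ ⟶ X₁, f = g ≫ i := Triangle.coyoneda_exact₂ _ hT f hfp
  rw [hg, eq_zero_of_isLE_of_projective P n (m := n - 1) (by lia) g, zero_comp]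

theorem homologyFunctor_map_surjective_of_projective :
    Function.Surjective ((DerivedCategory.homologyFunctor C n).map :
      ((DerivedCategory.singleFunctor C n).obj P ⟶ X) → _) := by
  let S := (HomologicalComplex.single C (ComplexShape.up ℤ) n).obj P
  suffices h : ∀ φ : (DerivedCategory.homologyFunctor C n).obj (DerivedCategory.Q.obj S) ⟶
      (DerivedCategory.homologyFunctor C n).obj X, ∃ f : DerivedCategory.Q.obj S ⟶ X,
        (DerivedCategory.homologyFunctor C n).map f = φ from h
  intro φ
  obtain ⟨K, ⟨e⟩⟩ : ∃ K, Nonempty (DerivedCategory.Q.obj K ≅ X) :=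
    ⟨_, ⟨DerivedCategory.Q.objObjPreimageIso X⟩⟩
  let q (L : CochainComplex C ℤ) :
      (DerivedCategory.homologyFunctor C n).obj (DerivedCategory.Q.obj L) ≅ L.homology n :=
    (DerivedCategory.homologyFunctorFactors C n).app L
  obtain ⟨g, hg⟩ := exists_single_hom_homologyMap_eq P n K
    ((q S).inv ≫ φ ≫ (DerivedCategory.homologyFunctor C n).map e.inv ≫ (q K).hom)
  have hq : (DerivedCategory.homologyFunctor C n).map (DerivedCategory.Q.map g) ≫ (q K).hom =
      (q S).hom ≫ HomologicalComplex.homologyMap g n :=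
    DerivedCategory.homologyFunctorFactors_hom_naturality g n
  have hQg : (DerivedCategory.homologyFunctor C n).map (DerivedCategory.Q.map g) =
      φ ≫ (DerivedCategory.homologyFunctor C n).map e.inv := by
    rw [← cancel_mono (q K).hom, hq, hg, Iso.hom_inv_id_assoc, Category.assoc]
  refine ⟨DerivedCategory.Q.map g ≫ e.hom, ?_⟩
  rw [Functor.map_comp, hQg, Category.assoc, ← Functor.map_comp, e.inv_hom_id,
    CategoryTheory.Functor.map_id, Category.comp_id]

/-- The cohomology of a stalk complex. -/
noncomputable def homologySingleIso (M : C) (n : ℤ) :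
    (DerivedCategory.homologyFunctor C n).obj ((DerivedCategory.singleFunctor C n).obj M) ≅ M :=
  (DerivedCategory.homologyFunctorFactors C n).app _ ≪≫
    HomologicalComplex.singleObjHomologySelfIso _ n M

theorem isZero_homologyFunctor_shift_iff (X : DerivedCategory.Bounded C) {n m a : ℤ}
    (h : n + m = a) :
    IsZero ((DerivedCategory.homologyFunctor C m).obj (X⟦n⟧).obj) ↔
      IsZero ((DerivedCategory.homologyFunctor C a).obj X.obj) :=
  ((DerivedCategory.homologyFunctor C m).mapIso
      ((DerivedCategory.Bounded.ι.commShiftIso n).app X) ≪≫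
    ((DerivedCategory.homologyFunctor C 0).shiftIso n m a h).app X.obj).isZero_iff

theorem detectsCohomology_stalk {P : C} [Projective P] (hP : IsSeparator P) :
    DetectsCohomology (stalk P) := by
  intro X n
  rw [← isZero_homologyFunctor_shift_iff X (add_zero n)]
  constructor
  · intro h f
    exact ObjectProperty.hom_ext _ (eq_zero_of_isZero_homology P 0 h f.hom)
  · intro h
    rw [IsZero.iff_id_eq_zero]
    refine (Preadditive.isSeparator_iff P).1 hP _ fun φ => ?_
    obtain ⟨f, hf⟩ := homologyFunctor_map_surjective_of_projective P 0
      ((homologySingleIso P 0).hom ≫ φ)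
    have hf₀ : f = 0 := congrArg (fun g => g.hom) (h (ObjectProperty.homMk f))
    rw [← cancel_epi (homologySingleIso P 0).hom, Category.comp_id, comp_zero, ← hf, hf₀,
      Functor.map_zero]

end Projective

section HomFinite

variable {k : Type u'} [CommRing k]

theorem isContravariantlyFinite_of_finite_hom {C : Type u} [Category.{v} C] [Abelian C]
    [HasDerivedCategory.{w} C] [Linear k C] {T : DerivedCategory.Bounded C}
    (hT : ∀ Y : DerivedCategory.Bounded C, Module.Finite k (T ⟶ Y)) :
    IsContravariantlyFinite T := by
  intro Y
  have := hT Y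
  obtain ⟨n, e, he⟩ := Module.Finite.exists_fin (R := k) (M := T ⟶ Y)
  refine ⟨⨁ fun _ : Fin n => T, biproduct.desc e, addClosure_biproduct T n, fun g => ?_⟩
  have hg : g ∈ Submodule.span k (Set.range e) := he ▸ Submodule.mem_top
  obtain ⟨c, rfl⟩ := (Submodule.mem_span_range_iff_exists_fun k).1 hg
  refine ⟨biproduct.lift fun i => c i • 𝟙 T, ?_⟩
  simp only [biproduct.lift_desc, Linear.smul_comp, Category.id_comp]

variable [IsNoetherianRing k]

theorem finite_hom_obj₂ {𝒯 : Type u} [Category.{v} 𝒯] [Preadditive 𝒯] [Linear k 𝒯]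
    [HasZeroObject 𝒯] [HasShift 𝒯 ℤ] [∀ n : ℤ, (shiftFunctor 𝒯 n).Additive] [Pretriangulated 𝒯]
    {T : Triangle 𝒯} (hT : T ∈ distTriang 𝒯) {Y : 𝒯} (h₁ : Module.Finite k (T.obj₁ ⟶ Y))
    (h₃ : Module.Finite k (T.obj₃ ⟶ Y)) : Module.Finite k (T.obj₂ ⟶ Y) := by
  have := isNoetherian_of_isNoetherianRing_of_finite k (T.obj₁ ⟶ Y)
  have := isNoetherian_of_isNoetherianRing_of_finite k (T.obj₃ ⟶ Y)
  have := isNoetherian_of_range_eq_ker (Linear.leftComp k Y T.mor₂) (Linear.leftComp k Y T.mor₁) (by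
    ext φ
    constructor
    · rintro ⟨ψ, rfl⟩
      simp [reassoc_of% comp_distTriang_mor_zero₁₂ _ hT]
    · intro hφ
      obtain ⟨ψ, rfl⟩ := Triangle.yoneda_exact₂ _ hT φ hφ
      exact ⟨ψ, rfl⟩)
  infer_instance

variable {C : Type u} [Category.{v} C] [Abelian C] [HasDerivedCategory.{w} C]

theorem exists_projective_cover_of_isLE [EnoughProjectives C] (X : DerivedCategory C) (b : ℤ)
    [X.IsLE b] : ∃ (P : C) (_ : Projective P) (Z : DerivedCategory C) (_ : Z.IsLE (b - 1))
      (f : (DerivedCategory.singleFunctor C b).obj P ⟶ X) (g : X ⟶ Z) (h : Z ⟶ _),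
      Triangle.mk f g h ∈ distTriang (DerivedCategory C) := by
  let H := (DerivedCategory.homologyFunctor C b).obj X
  let P := Projective.over H
  obtain ⟨f, hf⟩ := homologyFunctor_map_surjective_of_projective P b
    ((homologySingleIso P b).hom ≫ Projective.π H)
  obtain ⟨Z, g, h, hT⟩ := distinguished_cocone_triangle f
  refine ⟨P, inferInstance, Z, ?_, f, g, h, hT⟩
  rw [DerivedCategory.isLE_iff]
  intro i hi
  have hP : IsZero ((DerivedCategory.homologyFunctor C (i + 1)).obj
      ((DerivedCategory.singleFunctor C b).obj P)) :=
    DerivedCategory.isZero_of_isLE _ b _ (by lia)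
  have hg : (DerivedCategory.homologyFunctor C i).map g = 0 := by
    obtain rfl | hib : i = b ∨ b < i := by lia
    · refine (DerivedCategory.HomologySequence.epi_homologyMap_mor₁_iff _ hT i).1 ?_
      change Epi ((DerivedCategory.homologyFunctor C i).map f)
      rw [hf]
      infer_instance
    · exact (DerivedCategory.isZero_of_isLE X b i hib).eq_of_src _ _
  exact (DerivedCategory.HomologySequence.exact₃ _ hT i (i + 1) rfl).isZero_of_both_zeros hg
    (hP.eq_of_tgt _ _)

variable [Linear k C]

theorem finite_hom_singleFunctor_obj (hfin : ∀ M N : C, Module.Finite k (M ⟶ N)) (P : C)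
    [Projective P] (n : ℤ) (X : DerivedCategory C) :
    Module.Finite k ((DerivedCategory.singleFunctor C n).obj P ⟶ X) := by
  obtain ⟨K, ⟨e⟩⟩ : ∃ K, Nonempty (DerivedCategory.Q.obj K ≅ X) :=
    ⟨_, ⟨DerivedCategory.Q.objObjPreimageIso X⟩⟩
  let S := (CochainComplex.singleFunctor C n).obj P
  let ev : (S ⟶ K) →ₗ[k] (S.X n ⟶ K.X n) :=
    { toFun := fun f => f.f n
      map_add' := fun _ _ => rfl
      map_smul' := fun _ _ => rfl }
  have hev : Function.Injective ev := fun f g hfg => by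
    ext i
    by_cases hi : i = n
    · subst hi
      exact hfg
    · exact (HomologicalComplex.isZero_single_obj_X _ n P i hi).eq_of_src _ _
  have := hfin (S.X n) (K.X n)
  have : Module.Finite k (S ⟶ K) := Module.Finite.of_injective ev hev
  have : Module.Finite k (DerivedCategory.Q.obj S ⟶ DerivedCategory.Q.obj K) :=
    Module.Finite.of_surjective (DerivedCategory.Q.mapLinearMap k)
      (Q_map_surjective_of_isKProjective S K)
  exact Module.Finite.equiv (Linear.homCongr k (Iso.refl (DerivedCategory.Q.obj S)) e)

theorem finite_hom_of_isLE_of_isGE [EnoughProjectives C]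
    (hfin : ∀ M N : C, Module.Finite k (M ⟶ N)) (X Y : DerivedCategory C) (a b : ℤ)
    [hX : X.IsLE b] [Y.IsGE a] : Module.Finite k (X ⟶ Y) := by
  obtain ⟨n, hn⟩ : ∃ n : ℕ, b < a + n := ⟨(b + 1 - a).toNat, by lia⟩
  induction n generalizing X b with
  | zero =>
    have : Subsingleton (X ⟶ Y) := ⟨fun f g => by
      rw [DerivedCategory.TStructure.t.zero f b a (by lia),
        DerivedCategory.TStructure.t.zero g b a (by lia)]⟩
    infer_instance
  | succ n ih =>
    obtain ⟨P, _, Z, _, f, g, h, hT⟩ := exists_projective_cover_of_isLE X b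
    exact finite_hom_obj₂ hT (finite_hom_singleFunctor_obj hfin P b Y) (ih Z (b - 1) (by lia))

theorem finite_hom_of_bounded [EnoughProjectives C]
    (hfin : ∀ M N : C, Module.Finite k (M ⟶ N)) (X Y : DerivedCategory.Bounded C) :
    Module.Finite k (X ⟶ Y) := by
  let e : (X ⟶ Y) ≃ₗ[k] (X.obj ⟶ Y.obj) :=
    { toFun f := f.hom
      invFun f := ObjectProperty.homMk f
      map_add' _ _ := rfl
      map_smul' _ _ := rfl }
  obtain ⟨b, hb⟩ := X.property.2
  obtain ⟨a, ha⟩ := Y.property.1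
  have : X.obj.IsLE b := hb
  have : Y.obj.IsGE a := ha
  have := finite_hom_of_isLE_of_isGE hfin X.obj Y.obj a b
  exact Module.Finite.equiv e.symm

end HomFinite

section FGModuleCat

variable {A : Type u} [Ring A]

theorem isSeparator_fgModuleCat_of_self : IsSeparator (FGModuleCat.of A A) := by
  rw [Preadditive.isSeparator_iff]
  intro M N f hf
  ext x
  have hx := congrArg (fun g => g.hom.hom (1 : A))
    (hf (FGModuleCat.ofHom (LinearMap.toSpanSingleton A M x)))
  exact (congrArg f.hom.hom (one_smul A x)).symm.trans hx

variable [IsNoetherianRing A]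

theorem fgModuleCat_epi_iff_surjective {M N : FGModuleCat.{u} A} (f : M ⟶ N) :
    Epi f ↔ Function.Surjective f.hom.hom := by
  let U := forget₂ (FGModuleCat.{u} A) (ModuleCat.{u} A)
  exact ⟨fun _ => (ModuleCat.epi_iff_surjective (U.map f)).1 inferInstance,
    fun hf => U.epi_of_epi_map ((ModuleCat.epi_iff_surjective (U.map f)).2 hf)⟩

instance projective_fgModuleCat_of (P : Type u) [AddCommGroup P] [Module A P] [Module.Finite A P]
    [Module.Projective A P] : Projective (FGModuleCat.of A P) where
  factors f e _ := by
    obtain ⟨g, hg⟩ := Module.projective_lifting_property e.hom.hom f.hom.hom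
      ((fgModuleCat_epi_iff_surjective e).1 inferInstance)
    exact ⟨FGModuleCat.ofHom g, FGModuleCat.hom_ext hg⟩

instance enoughProjectives_fgModuleCat : EnoughProjectives (FGModuleCat.{u} A) where
  presentation M := by
    obtain ⟨n, f, hf⟩ := Module.Finite.exists_fin' A M
    exact ⟨{
      p := FGModuleCat.of A (Fin n → A)
      f := FGModuleCat.ofHom f
      epi := (fgModuleCat_epi_iff_surjective _).2 hf }⟩

end FGModuleCat

section ArtinAlgebra

variable (k R : Type u) [CommRing k] [Ring R] [Algebra k R] [IsArtinAlgebra k R]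

open scoped ModuleCat.Algebra in
/-- The `k`-linear structure on the category of finitely generated modules over an artin
`k`-algebra. -/
@[reducible]
noncomputable def linearFGModuleCat : Linear k (FGModuleCat.{u} R) :=
  inferInstanceAs (Linear k (ModuleCat.isFG.{u} R).FullSubcategory)

theorem finite_hom_fgModuleCat (M N : FGModuleCat.{u} R) :
    letI := linearFGModuleCat k R
    Module.Finite k (M ⟶ N) := by
  let := linearFGModuleCat k R
  have := IsArtinAlgebra.isArtinianRing (k := k) (R := R)
  have := IsArtinAlgebra.finite (k := k) (R := R)
  let _ : Module k N := Module.restrictScalars k R N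
  have : IsScalarTower k R N := IsScalarTower.restrictScalars k R N
  have : Module.Finite k N := Module.Finite.trans R N
  obtain ⟨n, s, hs⟩ := Module.Finite.exists_fin (R := R) (M := M)
  let ev : (M ⟶ N) →ₗ[k] (Fin n → N) :=
    { toFun := fun f i => f.hom.hom (s i)
      map_add' := fun _ _ => rfl
      map_smul' := fun _ _ => rfl }
  refine Module.Finite.of_injective ev fun f g hfg => ?_
  exact FGModuleCat.hom_ext (LinearMap.ext_on_range hs (congrFun hfg))

theorem isContravariantlyFinite_of_isArtinAlgebra [HasDerivedCategory.{w} (FGModuleCat.{u} R)]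
    (T : DerivedCategory.Bounded (FGModuleCat.{u} R)) : IsContravariantlyFinite T := by
  let := linearFGModuleCat k R
  have := IsArtinAlgebra.isArtinianRing (k := k) (R := R)
  exact isContravariantlyFinite_of_finite_hom (k := k)
    (finite_hom_of_bounded (finite_hom_fgModuleCat k R) T)

end ArtinAlgebra

section Reflexivity

variable {k : Type u} [CommRing k]

theorem IsInjectiveEnvelope.range_le_of_isSimpleModule {A : Type u} [Ring A] {M E N : Type u}
    [AddCommGroup M] [Module A M] [AddCommGroup E] [Module A E] [AddCommGroup N] [Module A N]
    {i : M →ₗ[A] E} (hi : IsInjectiveEnvelope i) [IsSimpleModule A N] (f : N →ₗ[A] E) :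
    LinearMap.range f ≤ LinearMap.range i := by
  rcases eq_bot_or_eq_top ((LinearMap.range i).comap f) with h | h
  · have hf : LinearMap.range f = ⊥ := hi.essential _ (by
      rw [← Submodule.map_comap_eq, h, Submodule.map_bot])
    exact hf ▸ bot_le
  · rw [LinearMap.range_eq_map, Submodule.map_le_iff_le_comap, h]

theorem exists_smul_eq_of_injective {J : Ideal k} [IsSemisimpleModule k (k ⧸ J)] {N : Type*}
    [AddCommGroup N] [Module k N] {f : N →ₗ[k] k ⧸ J} (hf : Function.Injective f)
    (g : N →ₗ[k] k ⧸ J) : ∃ c : k, c • f = g := by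
  obtain ⟨h, rfl⟩ := IsSemisimpleModule.extension_property f hf g
  obtain ⟨c, hc⟩ := Ideal.Quotient.mk_surjective (h 1)
  refine ⟨c, LinearMap.ext fun x => ?_⟩
  obtain ⟨a, ha⟩ := Ideal.Quotient.mk_surjective (f x)
  have hone : ∀ b : k, Ideal.Quotient.mk J b = b • (1 : k ⧸ J) := fun b => by
    rw [Algebra.smul_def, mul_one]
    rfl
  rw [LinearMap.smul_apply, LinearMap.comp_apply, ← ha, hone a, map_smul, ← hc, hone c, smul_comm]

theorem isSemisimpleModule_quotient_jacobson [IsArtinianRing k] :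
    IsSemisimpleModule k (k ⧸ Ring.jacobson k) :=
  (IsArtinian.isSemisimpleModule_iff_jacobson k _).2 (Module.jacobson_quotient_jacobson k k)

theorem exists_injective_toQuotientJacobson [IsArtinianRing k] (N : Type*) [AddCommGroup N]
    [Module k N] [IsSimpleModule k N] :
    ∃ f : N →ₗ[k] k ⧸ Ring.jacobson k, Function.Injective f := by
  have := isSemisimpleModule_quotient_jacobson (k := k)
  have := IsSimpleModule.nontrivial k N
  obtain ⟨x, hx⟩ := exists_ne (0 : N)
  let p : (k ⧸ Ring.jacobson k) →ₗ[k] N :=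
    (Ring.jacobson k).liftQ (LinearMap.toSpanSingleton k N x) fun a ha =>
      Module.mem_annihilator.1 (IsSemisimpleModule.jacobson_le_annihilator k N ha) x
  have hp : Function.Surjective p := fun y => by
    obtain ⟨a, rfl⟩ := IsSimpleModule.toSpanSingleton_surjective k hx y
    exact ⟨Ideal.Quotient.mk _ a, rfl⟩
  obtain ⟨s, hs⟩ := IsSemisimpleModule.lifting_property p hp LinearMap.id
  exact ⟨s, Function.LeftInverse.injective (g := p) fun y => LinearMap.congr_fun hs y⟩

theorem IsInjectiveEnvelope.isSimpleModule_hom [IsArtinianRing k] {E : Type u} [AddCommGroup E]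
    [Module k E] {i : (k ⧸ Ring.jacobson k) →ₗ[k] E} (hi : IsInjectiveEnvelope i) (N : Type u)
    [AddCommGroup N] [Module k N] [IsSimpleModule k N] : IsSimpleModule k (N →ₗ[k] E) := by
  have := isSemisimpleModule_quotient_jacobson (k := k)
  have hfac (f : N →ₗ[k] E) : ∃ g : N →ₗ[k] k ⧸ Ring.jacobson k, i ∘ₗ g = f := by
    refine ⟨(LinearEquiv.ofInjective i hi.injective).symm ∘ₗ
      f.codRestrict _ fun x => hi.range_le_of_isSimpleModule f ⟨x, rfl⟩, LinearMap.ext fun x => ?_⟩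
    exact congrArg Subtype.val
      ((LinearEquiv.ofInjective i hi.injective).apply_symm_apply _)
  obtain ⟨s, hs⟩ := exists_injective_toQuotientJacobson (k := k) N
  have := IsSimpleModule.nontrivial k N
  refine isSimpleModule_iff_toSpanSingleton_surjective.2 ⟨⟨i ∘ₗ s, 0, fun h => ?_⟩, ?_⟩
  · obtain ⟨x, hx⟩ := exists_ne (0 : N)
    exact hx ((hi.injective.comp hs) ((LinearMap.congr_fun h x).trans (map_zero (i ∘ₗ s)).symm))
  · intro f hf g
    obtain ⟨f, rfl⟩ := hfac f
    obtain ⟨g, rfl⟩ := hfac g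
    have hf' : f ≠ 0 := fun h => hf (by rw [h, LinearMap.comp_zero])
    obtain ⟨c, rfl⟩ := exists_smul_eq_of_injective (LinearMap.injective_of_ne_zero hf') g
    exact ⟨c, (LinearMap.comp_smul i c f).symm⟩

/-- Reflexivity of a module `N` with respect to `E`: the evaluation map from `N` to its double dual
`Hom(Hom(N, E), E)` is bijective. -/
def IsReflexiveFor (E N : Type*) [AddCommGroup E] [Module k E] [AddCommGroup N] [Module k N] :
    Prop :=
  Function.Bijective (LinearMap.applyₗ : N →ₗ[k] (N →ₗ[k] E) →ₗ[k] E)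

theorem IsReflexiveFor.of_subsingleton (E N : Type*) [AddCommGroup E] [Module k E]
    [AddCommGroup N] [Module k N] [Subsingleton N] : IsReflexiveFor (k := k) E N :=
  ⟨Function.injective_of_subsingleton _, fun Φ => ⟨0, LinearMap.ext fun f => by
    rw [map_zero, Subsingleton.elim f 0, map_zero, map_zero]⟩⟩

theorem IsReflexiveFor.of_exact {E N₁ N₂ N₃ : Type u} [AddCommGroup E] [Module k E]
    [Module.Injective k E] [AddCommGroup N₁] [Module k N₁] [AddCommGroup N₂] [Module k N₂]
    [AddCommGroup N₃] [Module k N₃] {f : N₁ →ₗ[k] N₂} {g : N₂ →ₗ[k] N₃}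
    (hf : Function.Injective f) (hfg : Function.Exact f g) (hg : Function.Surjective g)
    (h₁ : IsReflexiveFor (k := k) E N₁) (h₃ : IsReflexiveFor (k := k) E N₃) :
    IsReflexiveFor (k := k) E N₂ := by
  have hsurj {M M' : Type u} [AddCommGroup M] [Module k M] [AddCommGroup M'] [Module k M']
      {u : M →ₗ[k] M'} (hu : Function.Injective u) : Function.Surjective (u.lcomp k E) :=
    Module.Injective.extension_property k E _ _ u hu
  have hfg' := LinearMap.exact_lcomp_of_exact_of_surjective E hfg hg
  have hg' : Function.Injective (g.lcomp k E) := LinearMap.lcomp_injective_of_surjective g hg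
  exact LinearMap.bijective_of_surjective_of_bijective_of_bijective_of_injective
    (0 : PUnit.{u + 1} →ₗ[k] N₁) f g (0 : N₃ →ₗ[k] PUnit.{u + 1})
    (0 : PUnit.{u + 1} →ₗ[k] _) ((f.lcomp k E).lcomp k E) ((g.lcomp k E).lcomp k E)
    (0 : _ →ₗ[k] PUnit.{u + 1}) 0 LinearMap.applyₗ LinearMap.applyₗ LinearMap.applyₗ 0
    (by rw [LinearMap.comp_zero, LinearMap.comp_zero]) rfl rfl rfl
    ((LinearMap.exact_zero_iff_injective _ _).2 hf) hfg
    ((LinearMap.exact_zero_iff_surjective _ _).2 hg)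
    ((LinearMap.exact_zero_iff_injective _ _).2
      (LinearMap.lcomp_injective_of_surjective _ (hsurj hf)))
    (LinearMap.exact_lcomp_of_exact_of_surjective E hfg' (hsurj hf))
    ((LinearMap.exact_zero_iff_surjective _ _).2 (hsurj hg'))
    (fun x => ⟨0, Subsingleton.elim _ _⟩) h₁ h₃ (Function.injective_of_subsingleton _)

variable [IsArtinianRing k] {E : Type u} [AddCommGroup E] [Module k E]
  {i : (k ⧸ Ring.jacobson k) →ₗ[k] E}

theorem IsInjectiveEnvelope.isReflexiveFor_of_isSimpleModule (hi : IsInjectiveEnvelope i)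
    (N : Type u) [AddCommGroup N] [Module k N] [IsSimpleModule k N] :
    IsReflexiveFor (k := k) E N := by
  have := hi.isSimpleModule_hom N
  have := hi.isSimpleModule_hom (N →ₗ[k] E)
  have := IsSimpleModule.nontrivial k (N →ₗ[k] E)
  obtain ⟨f, hf⟩ := exists_ne (0 : N →ₗ[k] E)
  refine LinearMap.bijective_of_ne_zero fun h => hf (LinearMap.ext fun x => ?_)
  exact LinearMap.congr_fun (LinearMap.congr_fun h x) f

theorem IsInjectiveEnvelope.isReflexiveFor (hi : IsInjectiveEnvelope i) (N : Type u)
    [AddCommGroup N] [Module k N] [Module.Finite k N] : IsReflexiveFor (k := k) E N := by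
  have hN : IsFiniteLength k N :=
    isFiniteLength_iff_isNoetherian_isArtinian.2 ⟨inferInstance, inferInstance⟩
  have := hi.injective_module
  induction hN with
  | of_subsingleton => exact .of_subsingleton E _
  | @of_simple_quotient _ _ _ N _ _ ih =>
    exact .of_exact N.subtype_injective (LinearMap.exact_subtype_mkQ N) N.mkQ_surjective ih
      (hi.isReflexiveFor_of_isSimpleModule _)

end Reflexivity

section Bidual

variable {k R S : Type u} [CommRing k] [Ring R] [Algebra k R] [Ring S] [Algebra k S]

/-- The evaluation map from an `R`-module to its double dual. The hypothesis on `σ` and `τ` says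
that they are mutually opposite, so that the double dual is again a module over `R`. -/
noncomputable def evalBidual (σ : S ≃ₐ[k] Rᵐᵒᵖ) (τ : R ≃ₐ[k] Sᵐᵒᵖ)
    (h : ∀ r : R, σ (τ r).unop = MulOpposite.op r) (M : Type u) [AddCommGroup M] [Module R M] :
    M →ₗ[R] DualModule τ (DualModule σ M) where
  toFun x := (show RestrictScalars k S (DualModule σ M) →ₗ[k] dualizingModule k from
    { toFun := fun f => (show DualModule σ M from f) x
      map_add' := fun _ _ => rfl
      map_smul' := fun c f => by
        change (show DualModule σ M from f) ((σ (algebraMap k S c)).unop • x) = _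
        rw [AlgEquiv.commutes, MulOpposite.algebraMap_apply, MulOpposite.unop_op,
          DualModule.map_algebraMap_smul, RingHom.id_apply] })
  map_add' x y := DualModule.ext τ fun f => map_add f x y
  map_smul' r x := DualModule.ext τ fun f => by
    change f (r • x) = ((τ r).unop • f) x
    rw [DualModule.smul_apply, h, MulOpposite.unop_op]

theorem bijective_evalBidual (σ : S ≃ₐ[k] Rᵐᵒᵖ) (τ : R ≃ₐ[k] Sᵐᵒᵖ)
    (h : ∀ r : R, σ (τ r).unop = MulOpposite.op r)
    [IsArtinAlgebra k R] (M : Type u) [AddCommGroup M] [Module R M]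
    [Module.Finite R M] : Function.Bijective (evalBidual σ τ h M) := by
  have := IsArtinAlgebra.isArtinianRing (k := k) (R := R)
  have := IsArtinAlgebra.finite (k := k) (R := R)
  let _ : Module k M := Module.restrictScalars k R M
  have : IsScalarTower k R M := IsScalarTower.restrictScalars k R M
  have : Module.Finite k M := Module.Finite.trans R M
  obtain ⟨i, hi⟩ := dualizingModule_spec k
  obtain ⟨hinj, hsurj⟩ := hi.isReflexiveFor M
  constructor
  · intro x y hxy
    exact hinj (LinearMap.ext fun f => DFunLike.congr_fun hxy (show DualModule σ M from f))
  · intro Φ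
    let Φ' : (M →ₗ[k] dualizingModule k) →ₗ[k] dualizingModule k :=
      { toFun := fun f => Φ (show DualModule σ M from f)
        map_add' := fun f g => map_add Φ (show DualModule σ M from f) (show DualModule σ M from g)
        map_smul' := fun c f => by
          rw [RingHom.id_apply, ← DualModule.map_algebraMap_smul]
          exact congrArg Φ (algebraMap_smul S c (show DualModule σ M from f)).symm }
    obtain ⟨x, hx⟩ := hsurj Φ'
    exact ⟨x, DualModule.ext τ fun f => LinearMap.congr_fun hx f⟩

variable [IsArtinAlgebra k R] [IsArtinAlgebra k S]

/-- The evaluation isomorphism from the identity to the double dual. -/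
noncomputable def bidualIso (σ : S ≃ₐ[k] Rᵐᵒᵖ) (τ : R ≃ₐ[k] Sᵐᵒᵖ)
    (h : ∀ r : R, σ (τ r).unop = MulOpposite.op r) :
    𝟭 (FGModuleCat.{u} R) ≅ (dualFunctor σ).rightOp ⋙ dualFunctor τ :=
  NatIso.ofComponents fun M =>
    (LinearEquiv.ofBijective (evalBidual σ τ h M)
      (bijective_evalBidual σ τ h M)).toFGModuleCatIso

theorem isEquivalence_dualFunctor (σ : S ≃ₐ[k] Rᵐᵒᵖ) (τ : R ≃ₐ[k] Sᵐᵒᵖ)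
    (h : ∀ r : R, σ (τ r).unop = MulOpposite.op r) :
    (dualFunctor (R := R) σ).IsEquivalence := by
  have h' (s : S) : τ (σ s).unop = MulOpposite.op s :=
    MulOpposite.unop_injective (σ.injective (h (σ s).unop))
  exact (CategoryTheory.Equivalence.mk (dualFunctor σ) (dualFunctor τ).rightOp
    (NatIso.op (bidualIso σ τ h)).symm (bidualIso τ σ h').symm).isEquivalence_functor

end Bidual

section Regular

variable (k R : Type u) [CommRing k] [Ring R] [Algebra k R] [IsArtinAlgebra k R]

instance isEquivalence_dualFunctor_refl :
    (dualFunctor (R := R) (AlgEquiv.refl : Rᵐᵒᵖ ≃ₐ[k] Rᵐᵒᵖ)).IsEquivalence :=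
  isEquivalence_dualFunctor AlgEquiv.refl (AlgEquiv.opOp k R) fun _ => rfl

/-- The dual of `DR` is the right regular module. -/
noncomputable def dualDualRegularIso : (dualFunctor (AlgEquiv.refl : Rᵐᵒᵖ ≃ₐ[k] Rᵐᵒᵖ)).obj
    (op (dualRegular k R)) ≅ FGModuleCat.of Rᵐᵒᵖ Rᵐᵒᵖ :=
  ((bidualIso (AlgEquiv.opOp k R) (AlgEquiv.refl : Rᵐᵒᵖ ≃ₐ[k] Rᵐᵒᵖ) fun _ => rfl).app _).symm

end Regular

section ContraMap

variable {C : Type u} [Category.{v} C] [Abelian C] {C' : Type u'} [Category.{v'} C'] [Abelian C']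

theorem quasiIso_opEquivalence_map_iff {K L : CochainComplex C ℤ} (f : K ⟶ L) :
    QuasiIso ((CochainComplex.opEquivalence C).functor.map f.op) ↔ QuasiIso f := by
  refine ⟨fun hf => ?_, fun _ => quasiIso_opEquivalence_map f⟩
  rw [quasiIso_iff] at hf ⊢
  intro n
  have h := hf (-n)
  rw [quasiIsoAt_iff' _ (-(n + 1)) (-n) (-(n - 1)) (by simp; lia) (by simp; lia)] at h
  have h' := (ShortComplex.quasiIso_opMap_iff
    ((HomologicalComplex.shortComplexFunctor' C (ComplexShape.up ℤ)
      (- -(n - 1)) (- -n) (- -(n + 1))).map f)).1 h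
  rw [neg_neg, neg_neg, neg_neg] at h'
  rwa [quasiIsoAt_iff' _ (n - 1) n (n + 1) (by simp) (by simp)]

variable (F : Cᵒᵖ ⥤ C') [F.Additive]

theorem exactAt_contraMapComplex_iff [F.Faithful] [F.PreservesHomology] (K : CochainComplex C ℤ)
    (n m : ℤ) (h : n + m = 0) :
    ((contraMapComplex F).obj (op K)).ExactAt m ↔ K.ExactAt n := by
  obtain rfl : n = -m := by lia
  rw [HomologicalComplex.exactAt_iff' _ (m - 1) m (m + 1) (by simp) (by simp),
    HomologicalComplex.exactAt_iff' _ (-(m + 1)) (-m) (-(m - 1)) (by simp; lia) (by simp; lia)]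
  exact (ShortComplex.exact_map_iff_of_faithful (K.sc' (-(m + 1)) (-m) (-(m - 1))).op F).trans
    (ShortComplex.exact_op_iff _)

/-- If `X` is represented by the complex `K`, then its dual is represented by the dual of `K`. -/
noncomputable def contraMapDerivedIsoOfQIso [F.PreservesHomology] [HasDerivedCategory.{w} C]
    [HasDerivedCategory.{w'} C'] {K : CochainComplex C ℤ} {X : DerivedCategory C}
    (e : DerivedCategory.Q.obj K ≅ X) :
    DerivedCategory.Q.obj ((contraMapComplex F).obj (op K)) ≅ (contraMapDerived F).obj (op X) :=
  ((contraMapDerivedFactors F).app (op K)).symm ≪≫ (contraMapDerived F).mapIso e.symm.op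

variable [F.IsEquivalence]

instance isEquivalence_contraMapComplex : (contraMapComplex F).IsEquivalence := by
  have : F.asEquivalence.functor.PreservesZeroMorphisms :=
    inferInstanceAs F.PreservesZeroMorphisms
  have : (F.mapHomologicalComplex (ComplexShape.up ℤ)).IsEquivalence :=
    inferInstanceAs (F.asEquivalence.mapHomologicalComplex
      (ComplexShape.up ℤ)).functor.IsEquivalence
  exact inferInstanceAs ((CochainComplex.opEquivalence C).functor ⋙
    F.mapHomologicalComplex (ComplexShape.up ℤ)).IsEquivalence

theorem exists_shortExact_contraMapComplex {S : ShortComplex (CochainComplex C' ℤ)}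
    (hS : S.ShortExact) : ∃ S' : ShortComplex (CochainComplex C ℤ), S'.ShortExact ∧
      Nonempty ((contraMapComplex F).obj (op S'.X₁) ≅ S.X₃) ∧
      Nonempty ((contraMapComplex F).obj (op S'.X₂) ≅ S.X₂) ∧
      Nonempty ((contraMapComplex F).obj (op S'.X₃) ≅ S.X₁) :=
  ⟨(S.map (contraMapComplex F).inv).unop, (hS.map_of_exact (contraMapComplex F).inv).unop,
    ⟨(contraMapComplex F).asEquivalence.counitIso.app S.X₃⟩,
    ⟨(contraMapComplex F).asEquivalence.counitIso.app S.X₂⟩,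
    ⟨(contraMapComplex F).asEquivalence.counitIso.app S.X₁⟩⟩

variable [F.PreservesHomology]

theorem quasiIso_contraMapComplex_map_iff {K L : CochainComplex C ℤ} (f : K ⟶ L) :
    QuasiIso ((contraMapComplex F).map f.op) ↔ QuasiIso f :=
  (HomologicalComplex.quasiIso_map_iff_of_preservesHomology
    ((CochainComplex.opEquivalence C).functor.map f.op) F).trans
    (quasiIso_opEquivalence_map_iff f)

/-- The functor on complexes induced by an exact duality, as a morphism of localizers for the
quasi-isomorphisms; it shows that the functor on derived categories is an equivalence. -/
def contraMapLocalizer : LocalizerMorphism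
    (HomologicalComplex.quasiIso C (ComplexShape.up ℤ)).op
    (HomologicalComplex.quasiIso C' (ComplexShape.up ℤ)) where
  functor := contraMapComplex F
  map _ _ f hf := (quasiIso_contraMapComplex_map_iff F f.unop).2 hf

variable [HasDerivedCategory.{w} C] [HasDerivedCategory.{w'} C']

instance isEquivalence_contraMapDerived : (contraMapDerived F).IsEquivalence := by
  have : (contraMapLocalizer F).functor.IsEquivalence := isEquivalence_contraMapComplex F
  have : (contraMapLocalizer F).IsInduced :=
    { inverseImage_eq := by
        ext _ _ f
        exact quasiIso_contraMapComplex_map_iff F f.unop }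
  have := (contraMapLocalizer F).isLocalizedEquivalence_of_isInduced
  have : CatCommSq (contraMapLocalizer F).functor DerivedCategory.Q.op DerivedCategory.Q
    (contraMapDerived F) := ⟨(contraMapDerivedFactors F).symm⟩
  exact (contraMapLocalizer F).isEquivalence DerivedCategory.Q.op DerivedCategory.Q
    (contraMapDerived F)

theorem isZero_homologyFunctor_Q_iff (K : CochainComplex C ℤ) (n : ℤ) :
    IsZero ((DerivedCategory.homologyFunctor C n).obj (DerivedCategory.Q.obj K)) ↔
      K.ExactAt n := by
  rw [HomologicalComplex.exactAt_iff_isZero_homology]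
  exact ((DerivedCategory.homologyFunctorFactors C n).app K).isZero_iff

theorem isZero_homologyFunctor_contraMapDerived_iff (X : DerivedCategory C) (n m : ℤ)
    (h : n + m = 0) :
    IsZero ((DerivedCategory.homologyFunctor C' m).obj ((contraMapDerived F).obj (op X))) ↔
      IsZero ((DerivedCategory.homologyFunctor C n).obj X) := by
  let e := DerivedCategory.Q.objObjPreimageIso X
  rw [← ((DerivedCategory.homologyFunctor C n).mapIso e).isZero_iff,
    isZero_homologyFunctor_Q_iff, ← exactAt_contraMapComplex_iff F _ n m h,
    ← isZero_homologyFunctor_Q_iff]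
  exact ((DerivedCategory.homologyFunctor C' m).mapIso
    (contraMapDerivedIsoOfQIso F e).symm).isZero_iff

theorem bounded_of_contraMapDerived {X : DerivedCategory C}
    (h : DerivedCategory.TStructure.t.bounded ((contraMapDerived F).obj (op X))) :
    DerivedCategory.TStructure.t.bounded X := by
  obtain ⟨⟨a, ha⟩, ⟨b, hb⟩⟩ := h
  have ha : ((contraMapDerived F).obj (op X)).IsGE a := ha
  have hb : ((contraMapDerived F).obj (op X)).IsLE b := hb
  rw [DerivedCategory.isGE_iff] at ha
  rw [DerivedCategory.isLE_iff] at hb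
  have h₁ : X.IsGE (-b) := (DerivedCategory.isGE_iff _ _).2 fun i hi =>
    (isZero_homologyFunctor_contraMapDerived_iff F X i (-i) (by lia)).1 (hb _ (by lia))
  have h₂ : X.IsLE (-a) := (DerivedCategory.isLE_iff _ _).2 fun i hi =>
    (isZero_homologyFunctor_contraMapDerived_iff F X i (-i) (by lia)).1 (ha _ (by lia))
  exact ⟨⟨-b, h₁⟩, ⟨-a, h₂⟩⟩

instance isEquivalence_contraMapBounded : (contraMapBounded F).IsEquivalence where
  faithful := inferInstanceAs
    (ObjectProperty.lift _ (DerivedCategory.Bounded.ι.op ⋙ contraMapDerived F) _).Faithful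
  full := inferInstanceAs
    (ObjectProperty.lift _ (DerivedCategory.Bounded.ι.op ⋙ contraMapDerived F) _).Full
  essSurj := ⟨fun Y => by
    let e := (contraMapDerived F).objObjPreimageIso Y.obj
    have hX := bounded_of_contraMapDerived F
      (DerivedCategory.TStructure.t.bounded.prop_of_iso e.symm Y.property)
    exact ⟨op ⟨_, hX⟩, ⟨ObjectProperty.isoMk _ e⟩⟩⟩

end ContraMap

section HasTriangle

variable {C : Type u} [Category.{v} C] [Abelian C] [HasDerivedCategory.{w} C]
  {X Y Z : DerivedCategory.Bounded C}

theorem HasTriangle.of_iso {X' Y' Z' : DerivedCategory.Bounded C} (h : HasTriangle X Y Z)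
    (e₁ : X ≅ X') (e₂ : Y ≅ Y') (e₃ : Z ≅ Z') : HasTriangle X' Y' Z' := by
  obtain ⟨f, g, h, hT⟩ := h
  refine ⟨e₁.inv ≫ f ≫ e₂.hom, e₂.inv ≫ g ≫ e₃.hom, e₃.inv ≫ h ≫ e₁.hom⟦1⟧',
    isomorphic_distinguished _ hT _ (Iso.symm (Triangle.isoMk _ _ e₁ e₂ e₃ ?_ ?_ ?_))⟩
  · exact (e₁.hom_inv_id_assoc _).symm
  · exact (e₂.hom_inv_id_assoc _).symm
  · exact (e₃.hom_inv_id_assoc _).symm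

theorem exists_shortExact_of_distinguished {T : Triangle (DerivedCategory C)}
    (hT : T ∈ distTriang (DerivedCategory C)) :
    ∃ S : ShortComplex (CochainComplex C ℤ), S.ShortExact ∧
      Nonempty (DerivedCategory.Q.obj S.X₁ ≅ T.obj₁) ∧
      Nonempty (DerivedCategory.Q.obj S.X₂ ≅ T.obj₂) ∧
      Nonempty (DerivedCategory.Q.obj S.X₃ ≅ T.obj₃) := by
  obtain ⟨K, L, φ, ⟨e⟩⟩ := (DerivedCategory.mem_distTriang_iff _).1 (inv_rot_of_distTriang _ hT)
  refine ⟨CochainComplex.mappingCone.triangleRotateShortComplex φ,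
    HomologicalComplex.shortExact_of_degreewise_shortExact _ fun n =>
      (CochainComplex.mappingCone.triangleRotateShortComplexSplitting φ n).shortExact,
    ⟨(Triangle.π₂.mapIso e).symm⟩, ⟨(Triangle.π₃.mapIso e).symm⟩,
    ⟨((DerivedCategory.Q.commShiftIso (1 : ℤ)).app K) ≪≫
      (shiftFunctor _ (1 : ℤ)).mapIso (Triangle.π₁.mapIso e).symm ≪≫
      (shiftFunctorCompIsoId (DerivedCategory C) (-1 : ℤ) 1 (by lia)).app T.obj₃⟩⟩

theorem HasTriangle.of_shortExact {S : ShortComplex (CochainComplex C ℤ)} (hS : S.ShortExact)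
    (e₁ : DerivedCategory.Q.obj S.X₁ ≅ X.obj) (e₂ : DerivedCategory.Q.obj S.X₂ ≅ Y.obj)
    (e₃ : DerivedCategory.Q.obj S.X₃ ≅ Z.obj) : HasTriangle X Y Z := by
  let f : X ⟶ Y := ObjectProperty.homMk (e₁.inv ≫ DerivedCategory.Q.map S.f ≫ e₂.hom)
  obtain ⟨Z', g, δ, hZ'⟩ := distinguished_cocone_triangle f
  have hf : DerivedCategory.Q.map S.f ≫ e₂.hom = e₁.hom ≫ f.hom :=
    (e₁.hom_inv_id_assoc _).symm
  let e := isoTriangleOfIso₁₂ _ _ (DerivedCategory.triangleOfSES_distinguished hS)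
    (DerivedCategory.Bounded.ι.map_distinguished _ hZ') e₁ e₂ hf
  let e' : Z'.obj ≅ Z.obj := (Triangle.π₃.mapIso e).symm ≪≫ e₃
  exact HasTriangle.of_iso ⟨f, g, δ, hZ'⟩ (Iso.refl X) (Iso.refl Y) (ObjectProperty.isoMk _ e')

theorem hasTriangle_iff_exists_shortExact :
    HasTriangle X Y Z ↔ ∃ S : ShortComplex (CochainComplex C ℤ), S.ShortExact ∧
      Nonempty (DerivedCategory.Q.obj S.X₁ ≅ X.obj) ∧
      Nonempty (DerivedCategory.Q.obj S.X₂ ≅ Y.obj) ∧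
      Nonempty (DerivedCategory.Q.obj S.X₃ ≅ Z.obj) := by
  constructor
  · rintro ⟨f, g, h, hT⟩
    exact exists_shortExact_of_distinguished (DerivedCategory.Bounded.ι.map_distinguished _ hT)
  · rintro ⟨S, hS, ⟨e₁⟩, ⟨e₂⟩, ⟨e₃⟩⟩
    exact .of_shortExact hS e₁ e₂ e₃

theorem exists_isZero_hasTriangle_shift (X : DerivedCategory.Bounded C) :
    ∃ Y, IsZero Y ∧ HasTriangle X Y (X⟦(1 : ℤ)⟧) :=
  ⟨_, isZero_zero _, _, _, _, rot_of_distTriang _ (contractible_distinguished X)⟩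

theorem HasTriangle.nonempty_iso_shift (h : HasTriangle X Y Z) (hY : IsZero Y) :
    Nonempty (Z ≅ X⟦(1 : ℤ)⟧) := by
  obtain ⟨f, g, h, hT⟩ := h
  have : IsIso h := (Triangle.isZero₂_iff_isIso₃ _ hT).1 hY
  exact ⟨asIso h⟩

end HasTriangle

section Transport

variable {C : Type u} [Category.{v} C] [Abelian C] {C' : Type u'} [Category.{v'} C'] [Abelian C']
  (F : Cᵒᵖ ⥤ C') [F.Additive] [F.PreservesHomology]
  [HasDerivedCategory.{w} C] [HasDerivedCategory.{w'} C'] {X Y Z T : DerivedCategory.Bounded C}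

theorem nonempty_contraMapBounded_stalk_iso (M : C) :
    Nonempty ((contraMapBounded F).obj (op (stalk M)) ≅ stalk (F.obj (op M))) := by
  let K := (CochainComplex.singleFunctor C 0).obj M
  have hz : ∀ n : ℤ, n ≠ 0 → IsZero (((contraMapComplex F).obj (op K)).X n) := fun n hn =>
    F.map_isZero (HomologicalComplex.isZero_single_obj_X (ComplexShape.up ℤ) 0 M (-n)
      (by lia)).op
  have h₁ : ((contraMapComplex F).obj (op K)).IsStrictlyGE 0 :=
    (CochainComplex.isStrictlyGE_iff _ _).2 fun n hn => hz n (by lia)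
  have h₂ : ((contraMapComplex F).obj (op K)).IsStrictlyLE 0 :=
    (CochainComplex.isStrictlyLE_iff _ _).2 fun n hn => hz n (by lia)
  obtain ⟨N, ⟨e⟩⟩ := ((contraMapComplex F).obj (op K)).exists_iso_single 0
  let i : F.obj (op M) ≅ N :=
    F.mapIso (HomologicalComplex.singleObjXSelf (ComplexShape.up ℤ) 0 M).op ≪≫
      (HomologicalComplex.eval C' (ComplexShape.up ℤ) 0).mapIso e ≪≫
      HomologicalComplex.singleObjXSelf (ComplexShape.up ℤ) 0 N
  let e' := e ≪≫ (CochainComplex.singleFunctor C' 0).mapIso i.symm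
  exact ⟨ObjectProperty.isoMk _ ((contraMapDerivedIsoOfQIso F
    (((DerivedCategory.singleFunctorIsoCompQ C 0).app M).symm)).symm ≪≫
    DerivedCategory.Q.mapIso e' ≪≫
    ((DerivedCategory.singleFunctorIsoCompQ C' 0).app (F.obj (op M))).symm)⟩

theorem nonempty_contraMapBounded_stalk_iso_of_iso {I : C} {P' : C'} (e : F.obj (op I) ≅ P') :
    Nonempty ((contraMapBounded F).obj (op (stalk I)) ≅ stalk P') := by
  obtain ⟨i⟩ := nonempty_contraMapBounded_stalk_iso F I
  exact ⟨i ≪≫ ObjectProperty.isoMk _ ((DerivedCategory.singleFunctor C' 0).mapIso e)⟩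

variable [F.IsEquivalence]

theorem nonempty_Q_iso_of_contraMapBounded_iso {K : CochainComplex C ℤ}
    (e : DerivedCategory.Q.obj ((contraMapComplex F).obj (op K)) ≅
      ((contraMapBounded F).obj (op X)).obj) : Nonempty (DerivedCategory.Q.obj K ≅ X.obj) :=
  ⟨((contraMapDerived F).preimageIso
    ((contraMapDerivedIsoOfQIso F (Iso.refl _)).symm ≪≫ e)).unop.symm⟩

theorem hasTriangle_contraMapBounded_iff :
    HasTriangle ((contraMapBounded F).obj (op Z)) ((contraMapBounded F).obj (op Y))
      ((contraMapBounded F).obj (op X)) ↔ HasTriangle X Y Z := by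
  rw [hasTriangle_iff_exists_shortExact, hasTriangle_iff_exists_shortExact]
  constructor
  · rintro ⟨S, hS, ⟨e₁⟩, ⟨e₂⟩, ⟨e₃⟩⟩
    obtain ⟨S', hS', ⟨e₁'⟩, ⟨e₂'⟩, ⟨e₃'⟩⟩ := exists_shortExact_contraMapComplex F hS
    exact ⟨S', hS',
      nonempty_Q_iso_of_contraMapBounded_iso F (DerivedCategory.Q.mapIso e₁' ≪≫ e₃),
      nonempty_Q_iso_of_contraMapBounded_iso F (DerivedCategory.Q.mapIso e₂' ≪≫ e₂),
      nonempty_Q_iso_of_contraMapBounded_iso F (DerivedCategory.Q.mapIso e₃' ≪≫ e₁)⟩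
  · rintro ⟨S, hS, ⟨e₁⟩, ⟨e₂⟩, ⟨e₃⟩⟩
    exact ⟨S.op.map (contraMapComplex F), hS.op.map_of_exact _,
      ⟨contraMapDerivedIsoOfQIso F e₃⟩, ⟨contraMapDerivedIsoOfQIso F e₂⟩,
      ⟨contraMapDerivedIsoOfQIso F e₁⟩⟩

theorem cohomologyIn_contraMapBounded_iff {a b a' b' : ℤ} (ha : a + a' = 0) (hb : b + b' = 0) :
    cohomologyIn b' a' ((contraMapBounded F).obj (op X)) ↔ cohomologyIn a b X := by
  have hmem (n : ℤ) : n ∈ Set.Icc a b ↔ -n ∈ Set.Icc b' a' := by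
    simp only [Set.mem_Icc]
    lia
  constructor
  · exact fun h n hn => (isZero_homologyFunctor_contraMapDerived_iff F X.obj n (-n) (by lia)).1
      (h (-n) fun h' => hn ((hmem n).2 h'))
  · exact fun h n hn => (isZero_homologyFunctor_contraMapDerived_iff F X.obj (-n) n (by lia)).2
      (h (-n) fun h' => hn (neg_neg n ▸ (hmem _).1 h'))

theorem nonempty_contraMapBounded_iso_shift_one (X : DerivedCategory.Bounded C) :
    Nonempty ((contraMapBounded F).obj (op X) ≅
      ((contraMapBounded F).obj (op (X⟦(1 : ℤ)⟧)))⟦(1 : ℤ)⟧) := by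
  obtain ⟨Y, hY, h⟩ := exists_isZero_hasTriangle_shift X
  exact ((hasTriangle_contraMapBounded_iff F).2 h).nonempty_iso_shift
    ((contraMapBounded F).map_isZero hY.op)

theorem nonempty_contraMapBounded_iso_shift (X : DerivedCategory.Bounded C) (n : ℤ) :
    Nonempty ((contraMapBounded F).obj (op X) ≅
      ((contraMapBounded F).obj (op (X⟦n⟧)))⟦n⟧) := by
  have hstep (m : ℤ) : Nonempty (((contraMapBounded F).obj (op (X⟦m⟧)))⟦m⟧ ≅
      ((contraMapBounded F).obj (op (X⟦m + 1⟧)))⟦m + 1⟧) := by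
    obtain ⟨e⟩ := nonempty_contraMapBounded_iso_shift_one F (X⟦m⟧)
    let e' : (contraMapBounded F).obj (op (X⟦m⟧⟦(1 : ℤ)⟧)) ≅
        (contraMapBounded F).obj (op (X⟦m + 1⟧)) :=
      (contraMapBounded F).mapIso ((shiftFunctorAdd _ m 1).app X).op
    exact ⟨(shiftFunctor _ m).mapIso (e ≪≫ (shiftFunctor _ (1 : ℤ)).mapIso e') ≪≫
      ((shiftFunctorAdd' _ 1 m (m + 1) (by lia)).app _).symm⟩
  induction n using Int.induction_on with
  | zero =>
    exact ⟨(contraMapBounded F).mapIso ((shiftFunctorZero _ ℤ).app X).op ≪≫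
      ((shiftFunctorZero _ ℤ).app _).symm⟩
  | succ i ih =>
    obtain ⟨e⟩ := ih
    obtain ⟨e'⟩ := hstep i
    exact ⟨e ≪≫ e'⟩
  | pred i ih =>
    obtain ⟨e⟩ := ih
    obtain ⟨e'⟩ := hstep (-i - 1)
    rw [sub_add_cancel] at e'
    exact ⟨e ≪≫ e'.symm⟩

theorem nonempty_contraMapBounded_shift_iso (X : DerivedCategory.Bounded C) (n m : ℤ)
    (h : n + m = 0) : Nonempty ((contraMapBounded F).obj (op (X⟦n⟧)) ≅
      ((contraMapBounded F).obj (op X))⟦m⟧) := by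
  obtain ⟨e⟩ := nonempty_contraMapBounded_iso_shift F X n
  exact ⟨((shiftFunctor _ m).mapIso e ≪≫ (shiftFunctorCompIsoId _ n m h).app _).symm⟩

theorem homVanishes_contraMapBounded_iff {n : ℤ} :
    HomVanishes ((contraMapBounded F).obj (op Y)) ((contraMapBounded F).obj (op X)) n ↔
      HomVanishes X Y n := by
  obtain ⟨e⟩ := nonempty_contraMapBounded_iso_shift F Y n
  calc HomVanishes ((contraMapBounded F).obj (op Y)) ((contraMapBounded F).obj (op X)) n
    _ ↔ HomVanishes (((contraMapBounded F).obj (op (Y⟦n⟧)))⟦n⟧)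
          ((contraMapBounded F).obj (op X)) n :=
      ⟨fun h => h.of_iso e (Iso.refl _), fun h => h.of_iso e.symm (Iso.refl _)⟩
    _ ↔ HomVanishes ((contraMapBounded F).obj (op (Y⟦n⟧))) ((contraMapBounded F).obj (op X)) 0 :=
      HomVanishes.shift_left_iff n (by lia)
    _ ↔ ∀ f : (contraMapBounded F).obj (op (Y⟦n⟧)) ⟶ (contraMapBounded F).obj (op X), f = 0 :=
      HomVanishes.zero_iff
    _ ↔ ∀ f : op (Y⟦n⟧) ⟶ op X, f = 0 := by
      rw [(contraMapBounded F).map_surjective.forall]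
      exact forall_congr' fun f => (contraMapBounded F).map_eq_zero_iff
    _ ↔ HomVanishes X Y n := ⟨fun h f => Quiver.Hom.op_inj (h f.op),
      fun h f => Quiver.Hom.unop_inj (h f.unop)⟩

instance additive_contraMapBounded : (contraMapBounded F).Additive :=
  Functor.additive_of_preserves_binary_products _

theorem addClosure_contraMapBounded_iff :
    addClosure ((contraMapBounded F).obj (op X)) ((contraMapBounded F).obj (op Y)) ↔
      addClosure X Y := by
  constructor
  · intro h
    obtain ⟨n, f, g, hfg⟩ := h.exists_sum_eq_id
    refine .of_sum_eq_id (fun i => ((contraMapBounded F).preimage (g i)).unop)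
      (fun i => ((contraMapBounded F).preimage (f i)).unop) ?_
    refine Quiver.Hom.op_inj ((contraMapBounded F).map_injective ?_)
    rw [op_sum, Functor.map_sum]
    simpa using hfg
  · intro h
    obtain ⟨n, f, g, hfg⟩ := h.exists_sum_eq_id
    refine .of_sum_eq_id (fun i => (contraMapBounded F).map (g i).op)
      (fun i => (contraMapBounded F).map (f i).op) ?_
    have := congrArg (fun u => (contraMapBounded F).map u.op) hfg
    rw [op_sum, Functor.map_sum] at this
    simpa using this

theorem leftPerp_contraMapBounded_iff :
    leftPerp ((contraMapBounded F).obj (op T)) ((contraMapBounded F).obj (op X)) ↔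
      rightPerp T X :=
  forall₂_congr fun _ _ => homVanishes_contraMapBounded_iff F

theorem rightPerp_contraMapBounded_iff :
    rightPerp ((contraMapBounded F).obj (op T)) ((contraMapBounded F).obj (op X)) ↔
      leftPerp T X :=
  forall₂_congr fun _ _ => homVanishes_contraMapBounded_iff F

theorem isSemiSelforthogonal_contraMapBounded_iff :
    IsSemiSelforthogonal ((contraMapBounded F).obj (op T)) ↔ IsSemiSelforthogonal T :=
  rightPerp_contraMapBounded_iff F

end Transport

section OfIso

variable {C : Type u} [Category.{v} C] [Abelian C] [HasDerivedCategory.{w} C]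
  {T X X' : DerivedCategory.Bounded C}

theorem cohomologyIn.of_iso {a b : ℤ} (h : cohomologyIn a b X) (e : X ≅ X') :
    cohomologyIn a b X' :=
  fun n hn => (h n hn).of_iso
    ((DerivedCategory.Bounded.ι ⋙ DerivedCategory.homologyFunctor C n).mapIso e.symm)

theorem addClosure.of_iso (h : addClosure T X) (e : X ≅ X') : addClosure T X' := by
  obtain ⟨n, N', ⟨i⟩⟩ := h
  exact ⟨n, N', ⟨biprod.mapIso e.symm (Iso.refl N') ≪≫ i⟩⟩

theorem rightPerp.of_iso (h : rightPerp T X) (e : X ≅ X') : rightPerp T X' :=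
  fun i hi => HomVanishes.of_iso (h i hi) (Iso.refl T) e

theorem nonnegShifts.of_iso {P : ObjectProperty (DerivedCategory.Bounded C)}
    (h : nonnegShifts P X) (e : X ≅ X') : nonnegShifts P X' := by
  obtain ⟨n, Z, hn, hZ, ⟨i⟩⟩ := h
  exact ⟨n, Z, hn, hZ, ⟨e.symm ≪≫ i⟩⟩

theorem DetectsCohomology.of_iso (h : DetectsCohomology X) (e : X ≅ X') : DetectsCohomology X' :=
  fun Y n => (h Y n).trans
    ⟨fun h' => h'.of_iso e (Iso.refl Y), fun h' => h'.of_iso e.symm (Iso.refl Y)⟩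

end OfIso

section Duality

variable {C : Type u} [Category.{v} C] [Abelian C] {C' : Type u'} [Category.{v'} C'] [Abelian C']
  (F : Cᵒᵖ ⥤ C') [F.Additive] [F.PreservesHomology] [F.IsEquivalence]
  [HasDerivedCategory.{w} C] [HasDerivedCategory.{w'} C']
  {T X : DerivedCategory.Bounded C}

theorem coAuslanderClass_contraMapBounded (h : auslanderClass T X) :
    coAuslanderClass ((contraMapBounded F).obj (op T)) ((contraMapBounded F).obj (op X)) := by
  obtain ⟨a, b, hT, Y, N, rfl, h⟩ := h
  have hI (Z : DerivedCategory.Bounded C) (hZ : cohomologyIn a b Z) :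
      cohomologyIn (-b) (-a) ((contraMapBounded F).obj (op Z)) :=
    (cohomologyIn_contraMapBounded_iff F (add_neg_cancel a) (add_neg_cancel b)).2 hZ
  refine ⟨-b, -a, hI T hT, fun i => (contraMapBounded F).obj (op (Y i)),
    fun i => (contraMapBounded F).obj (op (N i)), rfl, fun i => ?_⟩
  obtain ⟨htri, hadd, hperp, hcoh⟩ := h i
  exact ⟨(hasTriangle_contraMapBounded_iff F).2 htri, (addClosure_contraMapBounded_iff F).2 hadd,
    (leftPerp_contraMapBounded_iff F).2 hperp, hI _ hcoh⟩

theorem exists_coAuslanderClass_of_auslanderClass {W : DerivedCategory.Bounded C'}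
    (h : auslanderClass ((contraMapBounded F).obj (op T)) W) :
    ∃ X, coAuslanderClass T X ∧ Nonempty ((contraMapBounded F).obj (op X) ≅ W) := by
  obtain ⟨a, b, hT, Y, N, rfl, h⟩ := h
  have hI (Z : DerivedCategory.Bounded C)
      (hZ : cohomologyIn a b ((contraMapBounded F).obj (op Z))) : cohomologyIn (-b) (-a) Z :=
    (cohomologyIn_contraMapBounded_iff F (neg_add_cancel b) (neg_add_cancel a)).1 hZ
  let eY (i : ℕ) := (contraMapBounded F).objObjPreimageIso (Y i)
  let eN (i : ℕ) := (contraMapBounded F).objObjPreimageIso (N i)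
  refine ⟨_, ⟨-b, -a, hI T hT, fun i => ((contraMapBounded F).objPreimage (Y i)).unop,
    fun i => ((contraMapBounded F).objPreimage (N i)).unop, rfl, fun i => ?_⟩, ⟨eY 0⟩⟩
  obtain ⟨htri, hadd, hperp, hcoh⟩ := h i
  exact ⟨(hasTriangle_contraMapBounded_iff F).1
      (htri.of_iso (eY (i + 1)).symm (eN i).symm (eY i).symm),
    (addClosure_contraMapBounded_iff F).1 (hadd.of_iso (eN i).symm),
    (rightPerp_contraMapBounded_iff F).1 (hperp.of_iso (eY i).symm),
    hI _ (hcoh.of_iso (eY i).symm)⟩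

theorem nonnegShifts_coAuslanderClass_contraMapBounded (h : nonposShifts (auslanderClass T) X) :
    nonnegShifts (coAuslanderClass ((contraMapBounded F).obj (op T)))
      ((contraMapBounded F).obj (op X)) := by
  obtain ⟨n, Z, hn, hZ, ⟨e⟩⟩ := h
  obtain ⟨i⟩ := nonempty_contraMapBounded_shift_iso F Z n (-n) (add_neg_cancel n)
  exact ⟨-n, _, by lia, coAuslanderClass_contraMapBounded F hZ,
    ⟨(contraMapBounded F).mapIso e.symm.op ≪≫ i⟩⟩

theorem nonnegShifts_coAuslanderClass_of_contraMapBounded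
    (h : nonposShifts (auslanderClass ((contraMapBounded F).obj (op T)))
      ((contraMapBounded F).obj (op X))) : nonnegShifts (coAuslanderClass T) X := by
  obtain ⟨n, W, hn, hW, ⟨e⟩⟩ := h
  obtain ⟨Z, hZ, ⟨e'⟩⟩ := exists_coAuslanderClass_of_auslanderClass F hW
  obtain ⟨i⟩ := nonempty_contraMapBounded_shift_iso F Z (-n) n (neg_add_cancel n)
  exact ⟨-n, Z, by lia, hZ, ⟨((contraMapBounded F).preimageIso
    (e ≪≫ (shiftFunctor _ n).mapIso e'.symm ≪≫ i.symm)).unop.symm⟩⟩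

theorem isZero_homologyFunctor_contraMapBounded_iff (Y : DerivedCategory.Bounded C) (n m : ℤ)
    (h : n + m = 0) :
    IsZero ((DerivedCategory.homologyFunctor C' m).obj ((contraMapBounded F).obj (op Y)).obj) ↔
      IsZero ((DerivedCategory.homologyFunctor C n).obj Y.obj) :=
  isZero_homologyFunctor_contraMapDerived_iff F Y.obj n m h

theorem CodetectsCohomology.of_detectsCohomology_contraMapBounded
    (h : DetectsCohomology ((contraMapBounded F).obj (op X))) : CodetectsCohomology X := by
  intro Y n
  rw [← homVanishes_contraMapBounded_iff F, ← h,
    isZero_homologyFunctor_contraMapBounded_iff F Y n (-n) (add_neg_cancel n)]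

theorem DetectsCohomology.codetectsCohomology_contraMapBounded (h : DetectsCohomology X) :
    CodetectsCohomology ((contraMapBounded F).obj (op X)) := by
  intro W n
  let Y := ((contraMapBounded F).objPreimage W).unop
  let e : (contraMapBounded F).obj (op Y) ≅ W := (contraMapBounded F).objObjPreimageIso W
  have hcoh : IsZero ((DerivedCategory.homologyFunctor C' n).obj W.obj) ↔ HomVanishes X Y (-n) := by
    rw [← h, ← isZero_homologyFunctor_contraMapBounded_iff F Y (-n) n (neg_add_cancel n)]
    exact ((DerivedCategory.Bounded.ι ⋙ DerivedCategory.homologyFunctor C' n).mapIso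
      e).isZero_iff.symm
  rw [hcoh, ← homVanishes_contraMapBounded_iff F]
  exact ⟨fun h' => h'.of_iso e (Iso.refl _), fun h' => h'.of_iso e.symm (Iso.refl _)⟩

end Duality

end WakamatsuSilting

theorem theorem3p8_general {C : Type u} [Category.{v} C] [Abelian C] {C' : Type u'}
    [Category.{v'} C'] [Abelian C'] [HasDerivedCategory.{w} C] [HasDerivedCategory.{w'} C']
    (F : Cᵒᵖ ⥤ C') [F.Additive] [F.PreservesHomology] [F.IsEquivalence]
    {P I : C} {P' : C'} [Projective P] [Projective P'] (hP : IsSeparator P) (hP' : IsSeparator P')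
    (e : F.obj (Opposite.op I) ≅ P') (T : DerivedCategory.Bounded C)
    (hT : IsContravariantlyFinite T)
    (hT' : IsContravariantlyFinite ((contraMapBounded F).obj (Opposite.op T))) :
    List.TFAE [
      IsSemiSelforthogonal T ∧ nonnegShifts (coAuslanderClass T) (stalk P),
      IsSemiSelforthogonal T ∧ nonposShifts (auslanderClass T) (stalk I),
      IsSemiSelforthogonal ((contraMapBounded F).obj (Opposite.op T)) ∧
        nonnegShifts (coAuslanderClass ((contraMapBounded F).obj (Opposite.op T))) (stalk P')] := by
  have hdet : DetectsCohomology (stalk P) := detectsCohomology_stalk hP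
  have hdet' : DetectsCohomology (stalk P') := detectsCohomology_stalk hP'
  obtain ⟨i⟩ := nonempty_contraMapBounded_stalk_iso_of_iso F e
  tfae_have 1 → 2 := fun ⟨hTT, h⟩ =>
    ⟨hTT, nonposShifts_auslanderClass_of_nonnegShifts_coAuslanderClass hdet
      (.of_detectsCohomology_contraMapBounded F (hdet'.of_iso i.symm)) hT hTT h⟩
  tfae_have 2 → 3 := fun ⟨hTT, h⟩ =>
    ⟨(isSemiSelforthogonal_contraMapBounded_iff F).2 hTT,
      (nonnegShifts_coAuslanderClass_contraMapBounded F h).of_iso i⟩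
  tfae_have 3 → 1 := fun ⟨hTT, h⟩ =>
    ⟨(isSemiSelforthogonal_contraMapBounded_iff F).1 hTT,
      nonnegShifts_coAuslanderClass_of_contraMapBounded F
        (nonposShifts_auslanderClass_of_nonnegShifts_coAuslanderClass hdet'
          (hdet.codetectsCohomology_contraMapBounded F) hT' hTT h)⟩
  tfae_finish

theorem theorem3p8 (k R : Type u) [CommRing k] [Ring R] [Algebra k R] [IsArtinAlgebra k R]
    [HasDerivedCategory.{w} (FGModuleCat.{u} R)]
    [HasDerivedCategory.{w'} (FGModuleCat.{u} Rᵐᵒᵖ)]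
    (T : DerivedCategory.Bounded (FGModuleCat.{u} R)) :
    List.TFAE [
      IsWakamatsuSilting R T,
      IsSemiSelforthogonal T ∧ nonposShifts (auslanderClass T) (stalk (dualRegular k R)),
      IsWakamatsuSilting Rᵐᵒᵖ ((derivedDual k R).obj (Opposite.op T))] :=
  theorem3p8_general _ isSeparator_fgModuleCat_of_self isSeparator_fgModuleCat_of_self
    (dualDualRegularIso k R) T (isContravariantlyFinite_of_isArtinAlgebra k R T)
    (isContravariantlyFinite_of_isArtinAlgebra k Rᵐᵒᵖ _)
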